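/- **Quantum Goldreich–Levin theorem.** Quantum circuits are finite sequences of arbitrary one- and two-qubit unitary gates, and the size of a circuit is its number of gates. For a circuit $C$ on $m$ qubits and a string $x\in\{0,1\}^n$ with $n\le m$, $C(x)$ denotes the result of measuring the first qubits of $C|x\rangle|0^{m-n}\rangle$ in the computational basis (the first $n$ qubits for a circuit that inverts or evaluates a function $\{0,1\}^n\to\{0,1\}^n$, the first qubit for a circuit that predicts a bit). Let $f:\{0,1\}^n\to\{0,1\}^n$ be a permutation. - $f$ is *quantumly $(\delta,T)$-hard to invert* if there is no quantum circuit $C$ of size at most $T$ with $\Pr_a[C(f(a))=a]\ge\delta$, where $a\in\{0,1\}^n$ is uniformly random. - Put $\tilde f(y,x)=(f(y),x)$ and $h(y,x)=y\cdot x$ (inner product modulo two) for $x,y\in\{0,1\}^n$. A quantum circuit $G$ *$(\delta,\varepsilon)$-predicts $h$ from $\tilde f$* if $$\Pr_y\Big[\Pr_x[G(\tilde f(y,x))=h(y,x)]\ge\tfrac12+\varepsilon\Big]\ge\delta ,$$ where $x,y$ are uniformly random; the inner probability is also over the measurement. Then there is an absolute constant $c>0$ such that the following holds for all $n$, all permutations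 $f$ of $\{0,1\}^n$, all real $\delta,\varepsilon$ and all $T\in\mathbb N$. Suppose that $f$ is quantumly $(\delta/2,T)$-hard to invert, and let $F$ be any quantum circuit, of size $S$, that computes $f$ (that is, $F(x)=f(x)$ with certainty for every $x$). Then every quantum circuit $G$ that $(\delta,\varepsilon)$-predicts $h$ from $\tilde f$ satisfies $$\mathrm{size}(G)+S\ \ge\ c\,T\varepsilon .$$ In particular, if $f$ is easy to compute in the sense that $S\le\tfrac c2\,T\varepsilon$, then $\mathrm{size}(G)\ge\tfrac c2\,T\varepsilon$, i.e. $G$ has size $\Omega(T\varepsilon)$, so that the dilution factor is $O(1/\varepsilon)$. -/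

import Mathlib

namespace QuantumGL

/-- Bit strings of length `n`; a bit is an element of `ZMod 2`, so that the inner product modulo two
of `y` and `x` is the dot product `y ⬝ᵥ x`. -/
abbrev Bits (n : ℕ) : Type := Fin n → ZMod 2

/-- A (not necessarily normalised) state vector of `m` qubits: an amplitude for every string. -/
abbrev QState (m : ℕ) : Type := Bits m → ℂ

/-- The computational basis state `|s⟩`. -/
def ket {m : ℕ} (s : Bits m) : QState m := fun x => if x = s then 1 else 0

/-- An elementary gate on `m` qubits: an arbitrary unitary on one qubit, or on two distinct
qubits. -/
inductive Gate (m : ℕ) : Type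
  | one (i : Fin m) (U : Matrix.unitaryGroup (ZMod 2) ℂ) : Gate m
  | two (i j : Fin m) (hij : i ≠ j) (U : Matrix.unitaryGroup (ZMod 2 × ZMod 2) ℂ) : Gate m

/-- The action of a gate on state vectors (the unitary acts on the named qubits, the identity acts
on all others). -/
noncomputable def Gate.apply {m : ℕ} : Gate m → QState m → QState m
  | .one i U, ψ => fun x =>
      ∑ c : ZMod 2, (U : Matrix (ZMod 2) (ZMod 2) ℂ) (x i) c * ψ (Function.update x i c)
  | .two i j _ U, ψ => fun x =>
      ∑ c : ZMod 2, ∑ d : ZMod 2,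
        (U : Matrix (ZMod 2 × ZMod 2) (ZMod 2 × ZMod 2) ℂ) (x i, x j) (c, d) *
          ψ (Function.update (Function.update x i c) j d)

/-- A quantum circuit on `m` qubits: the list of its gates, in the order in which they are
applied. -/
abbrev Circuit (m : ℕ) : Type := List (Gate m)

/-- The size of a circuit is its number of gates. -/
def Circuit.size {m : ℕ} (C : Circuit m) : ℕ := List.length C

/-- The unitary transformation computed by a circuit, applied to a state vector. -/
noncomputable def Circuit.run {m : ℕ} (C : Circuit m) (ψ : QState m) : QState m :=
  List.foldl (fun φ g => Gate.apply g φ) ψ C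

/-- The string `x` followed by zeros (used for `n ≤ m` only): the input `|x⟩|0^(m-n)⟩`. -/
def padZero {n : ℕ} (m : ℕ) (x : Bits n) : Bits m :=
  fun i => if h : (i : ℕ) < n then x ⟨i, h⟩ else 0

/-- The probability that measuring the first `k` of the `m` qubits of `C|x⟩|0^(m-n)⟩` in the
computational basis yields `z`. -/
noncomputable def Circuit.outProb {m n k : ℕ} (C : Circuit m) (_hn : n ≤ m) (hk : k ≤ m)
    (x : Bits n) (z : Bits k) : ℝ :=
  ∑ w : Bits m, if (∀ i : Fin k, w (Fin.castLE hk i) = z i) then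
    ‖Circuit.run C (ket (padZero m x)) w‖ ^ 2 else 0

/-- The circuit `C` computes `f`: on input `x` its output is `f x` with certainty. -/
def Circuit.Computes {m n : ℕ} (C : Circuit m) (hm : n ≤ m) (f : Bits n → Bits n) : Prop :=
  ∀ x : Bits n, Circuit.outProb C hm hm x (f x) = 1

/-- `Pr_a[C(f(a)) = a]`, for a uniformly random `a`. -/
noncomputable def Circuit.invProb {m n : ℕ} (C : Circuit m) (hm : n ≤ m)
    (f : Equiv.Perm (Bits n)) : ℝ :=
  (∑ a : Bits n, Circuit.outProb C hm hm (f a) a) / 2 ^ n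

/-- The permutation `f` is quantumly `(δ, T)`-hard to invert: no quantum circuit of size (at most)
`T`, with any number of auxiliary qubits, satisfies `Pr_a[C(f(a)) = a] ≥ δ`. -/
def QHardToInvert {n : ℕ} (f : Equiv.Perm (Bits n)) (δ : ℝ) (T : ℕ) : Prop :=
  ¬ ∃ (m : ℕ) (hm : n ≤ m) (C : Circuit m), Circuit.size C ≤ T ∧ δ ≤ Circuit.invProb C hm f

/-- The predicate `h(y, x) = y · x`. -/
def hardPred {n : ℕ} (y x : Bits n) : ZMod 2 := y ⬝ᵥ x

/-- The permutation `(y, x) ↦ (f y, x)`. -/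
def tildeMap {n : ℕ} (f : Equiv.Perm (Bits n)) : Equiv.Perm (Bits n × Bits n) :=
  Equiv.prodCongr f (Equiv.refl (Bits n))

/-- `Pr_x[G(f̃(y, x)) = h(y, x)]` for a uniformly random `x`, where `G` takes the two strings of
`f̃(y, x)` one after the other as its input, and outputs one bit. -/
noncomputable def Circuit.predProb {m n : ℕ} (G : Circuit m) (hm : n + n ≤ m) (hm₁ : 1 ≤ m)
    (f : Equiv.Perm (Bits n)) (y : Bits n) : ℝ :=
  (∑ x : Bits n, Circuit.outProb G hm hm₁
    (Fin.append (tildeMap f (y, x)).1 (tildeMap f (y, x)).2) (fun _ => hardPred y x)) / 2 ^ n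

/-- The circuit `G` `(δ, ε)`-predicts `h` from `f̃`:
`Pr_y[Pr_x[G(f̃(y, x)) = h(y, x)] ≥ 1/2 + ε] ≥ δ`. -/
def Circuit.Predicts {m n : ℕ} (G : Circuit m) (hm : n + n ≤ m) (hm₁ : 1 ≤ m)
    (f : Equiv.Perm (Bits n)) (δ ε : ℝ) : Prop :=
  δ ≤ (Set.ncard {y : Bits n | 1 / 2 + ε ≤ Circuit.predProb G hm hm₁ f y} : ℝ) / 2 ^ n

end QuantumGL

set_option linter.unusedSectionVars false

namespace QuantumGL

/-! ### Circuits on qubits labelled by an arbitrary type -/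

/-! A noisy predictor gives a noisy Bernstein–Vazirani algorithm. Put the candidate register in a
uniform superposition of strings x, run `G` on (f(y), x), apply Z to the predicted bit and undo the
preparation. The amplitude of the candidate y is then the mean over x of (-1)^(x·y) times the
expected sign of the prediction, that is, 2 Pr[correct] - 1 ≥ 2ε (`signC_amplitude`,
`signC_amplitude_eq`). Since ε bounds an amplitude and not merely a probability, O(1/ε) rounds of
amplitude amplification suffice (`AmpSetup.weight_grover`). The circuit for `f` recognises the right
candidate, because f(x) = f(y) forces x = y (`run_markC`).

Two points need care. First, the angle θ that governs amplification depends on y, whereas the number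
j of rounds must be the same for all inputs. `exists_iterations` averages over j ≤ N with N about
1/ε, using sine weights, and finds one j for which the mean success over all well predicted y is at
least 1/2; this is the loss from δ to δ/2. The averaging needs θ ≤ π/4, which an additional qubit in
the state |+⟩ guarantees by halving the weight of the marked strings.

Second, a round must cost O(size G + size F), with no term in n. Let B be the set of positions i
such that `F` touches qubit i or `G` touches the qubit of the i-th bit of x (`relevant`); it has at
most 2(size G + size F) elements. Outside B the permutation fixes every bit, and a well predicted y
vanishes: were y_i = 1 for an ignored bit x_i, flipping x_i would change the parity but not the
prediction, so the advantage would be zero. Hence superposition, copying, comparison and reflection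
can be confined to B and a few qubits of the predictor. `exists_angle` assembles the success bound,
`length_invC_le` the gate count. -/

/-- State vectors of qubits labelled by `ι`. -/
abbrev Amp (ι : Type) : Type := (ι → ZMod 2) → ℂ

/-- One- and two-qubit gates on qubits labelled by `ι`. -/
inductive LGate (ι : Type) : Type
  | one (i : ι) (U : Matrix.unitaryGroup (ZMod 2) ℂ) : LGate ι
  | two (i j : ι) (hij : i ≠ j) (U : Matrix.unitaryGroup (ZMod 2 × ZMod 2) ℂ) : LGate ι

/-- Circuits on qubits labelled by `ι`. -/
abbrev LCirc (ι : Type) : Type := List (LGate ι)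

section Basic

variable {ι κ : Type} [DecidableEq ι] [DecidableEq κ]

/-- The computational basis vector of a string. -/
def bket (s : ι → ZMod 2) [DecidableEq (ι → ZMod 2)] : Amp ι := fun x => if x = s then 1 else 0

/-- The action of a gate on state vectors. -/
noncomputable def LGate.apply : LGate ι → Amp ι → Amp ι
  | .one i U, ψ => fun x =>
      ∑ c : ZMod 2, (U : Matrix (ZMod 2) (ZMod 2) ℂ) (x i) c * ψ (Function.update x i c)
  | .two i j _ U, ψ => fun x =>
      ∑ c : ZMod 2, ∑ d : ZMod 2,
        (U : Matrix (ZMod 2 × ZMod 2) (ZMod 2 × ZMod 2) ℂ) (x i, x j) (c, d) *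
          ψ (Function.update (Function.update x i c) j d)

/-- The inverse gate. -/
noncomputable def LGate.inv : LGate ι → LGate ι
  | .one i U => .one i U⁻¹
  | .two i j h U => .two i j h U⁻¹

/-- The qubits on which a gate acts. -/
def LGate.touched : LGate ι → Finset ι
  | .one i _ => {i}
  | .two i j _ _ => {i, j}

/-- Relabelling the qubits of a gate. -/
def LGate.map (e : κ ↪ ι) : LGate κ → LGate ι
  | .one i U => .one (e i) U
  | .two i j h U => .two (e i) (e j) (fun h' => h (e.injective h')) U

/-- The transformation computed by a circuit. -/
noncomputable def LCirc.run (C : LCirc ι) (ψ : Amp ι) : Amp ι :=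
  List.foldl (fun φ g => LGate.apply g φ) ψ C

/-- The inverse circuit. -/
noncomputable def LCirc.inv (C : LCirc ι) : LCirc ι := (List.map LGate.inv C).reverse

/-- The qubits on which some gate of a circuit acts. -/
def LCirc.touched (C : LCirc ι) : Finset ι := C.foldr (fun g s => g.touched ∪ s) ∅

/-- Relabelling the qubits of a circuit. -/
def LCirc.emb (e : κ ↪ ι) (C : LCirc κ) : LCirc ι := List.map (LGate.map e) C

namespace LCirc

@[simp] lemma run_nil (ψ : Amp ι) : run [] ψ = ψ := rfl

@[simp] lemma run_cons (g : LGate ι) (C : LCirc ι) (ψ : Amp ι) :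
    run (g :: C) ψ = run C (g.apply ψ) := rfl

lemma run_append (C D : LCirc ι) (ψ : Amp ι) : run (C ++ D) ψ = run D (run C ψ) := by
  simp [run, List.foldl_append]

lemma inv_cons (g : LGate ι) (C : LCirc ι) : inv (g :: C) = inv C ++ [g.inv] := by
  simp [inv]

@[simp] lemma length_inv (C : LCirc ι) : (inv C).length = C.length := by simp [inv]

@[simp] lemma length_emb (e : κ ↪ ι) (C : LCirc κ) : (emb e C).length = C.length := by
  simp [emb]

@[simp] lemma touched_nil : touched ([] : LCirc ι) = ∅ := rfl

@[simp] lemma touched_cons (g : LGate ι) (C : LCirc ι) :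
    touched (g :: C) = g.touched ∪ touched C := rfl

/-- A gate touches at most two qubits. This is the source of all bounds in terms of circuit size
instead of n. -/
lemma card_touched_le (C : LCirc ι) : (touched C).card ≤ 2 * C.length := by
  induction C with
  | nil => simp
  | cons g C ih =>
    have hg : g.touched.card ≤ 2 := by
      cases g
      · simp [LGate.touched]
      · simpa [LGate.touched] using Finset.card_le_two
    simp only [touched_cons, List.length_cons]
    have := Finset.card_union_le g.touched (touched C)
    omega

end LCirc

lemma LGate.apply_add (g : LGate ι) (ψ φ : Amp ι) :
    g.apply (ψ + φ) = g.apply ψ + g.apply φ := by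
  cases g <;> funext x <;> simp [LGate.apply, mul_add, Finset.sum_add_distrib]

lemma LGate.apply_smul (g : LGate ι) (a : ℂ) (ψ : Amp ι) :
    g.apply (a • ψ) = a • g.apply ψ := by
  cases g <;> funext x <;> simp [LGate.apply, Finset.mul_sum, mul_left_comm]

namespace LCirc

lemma run_add (C : LCirc ι) (ψ φ : Amp ι) : run C (ψ + φ) = run C ψ + run C φ := by
  induction C generalizing ψ φ with
  | nil => rfl
  | cons g C ih => simp [LGate.apply_add, ih]

lemma run_smul (C : LCirc ι) (a : ℂ) (ψ : Amp ι) : run C (a • ψ) = a • run C ψ := by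
  induction C generalizing ψ with
  | nil => rfl
  | cons g C ih => simp [LGate.apply_smul, ih]

lemma run_zero (C : LCirc ι) : run C (0 : Amp ι) = 0 := by
  simpa using run_smul C 0 0

lemma run_neg (C : LCirc ι) (ψ : Amp ι) : run C (-ψ) = -run C ψ := by
  simpa using run_smul C (-1) ψ

lemma run_sub (C : LCirc ι) (ψ φ : Amp ι) : run C (ψ - φ) = run C ψ - run C φ := by
  rw [sub_eq_add_neg, run_add, run_neg, ← sub_eq_add_neg]

end LCirc

/-! ### Unitarity -/

/-- The inner product of two state vectors. -/
noncomputable def ip [Fintype ι] (ψ φ : Amp ι) : ℂ := ∑ w, star (ψ w) * φ w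

lemma unitary_sum_one {α : Type} [Fintype α] [DecidableEq α] (U : Matrix.unitaryGroup α ℂ)
    (a b : α) : ∑ c, (U⁻¹ : Matrix.unitaryGroup α ℂ).1 a c * U.1 c b = if a = b then 1 else 0 := by
  have h : (U⁻¹ * U).1 = (1 : Matrix α α ℂ) := by rw [inv_mul_cancel]; rfl
  have := congrFun (congrFun h a) b
  rwa [Matrix.one_apply] at this

lemma update_update_pair {i j : ι} (hij : i ≠ j) (x : ι → ZMod 2) (a b c d : ZMod 2) :
    Function.update (Function.update (Function.update (Function.update x i a) j b) i c) j d
      = Function.update (Function.update x i c) j d := by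
  funext q
  by_cases h1 : q = j
  · subst h1; simp
  · by_cases h2 : q = i
    · subst h2; simp [h1]
    · simp [h1, h2]

lemma LGate.apply_inv_apply (g : LGate ι) (ψ : Amp ι) : g.inv.apply (g.apply ψ) = ψ := by
  cases g with
  | one i U =>
    funext x
    simp only [LGate.inv, LGate.apply, Function.update_self, Function.update_idem,
      Finset.mul_sum]
    rw [Finset.sum_comm]
    simp only [← mul_assoc, ← Finset.sum_mul, unitary_sum_one]
    simp
  | two i j h U =>
    funext x
    simp only [LGate.inv, LGate.apply, Function.update_self, Function.update_of_ne h,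
      update_update_pair h]
    have key : ∀ (A : ZMod 2 → ZMod 2 → ℂ), ∑ c, ∑ d, A c d = ∑ p : ZMod 2 × ZMod 2, A p.1 p.2 :=
      fun A => (Fintype.sum_prod_type' A).symm
    simp only [key, Finset.mul_sum]
    rw [Finset.sum_comm]
    simp only [← mul_assoc, ← Finset.sum_mul, Prod.mk.eta, unitary_sum_one]
    simp

lemma LGate.ip_apply_left [Fintype ι] (g : LGate ι) (ψ φ : Amp ι) :
    ip (g.apply ψ) φ = ip ψ (g.inv.apply φ) := by
  cases g with
  | one i U =>
    simp only [ip, LGate.inv, LGate.apply, star_sum, star_mul', Finset.sum_mul, Finset.mul_sum]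
    rw [← Fintype.sum_prod_type', ← Fintype.sum_prod_type']
    -- Exchanging the bit `w i` with the summation variable is an involution that matches the two
    -- double sums term by term.
    refine Fintype.sum_bijective
      (fun p : (ι → ZMod 2) × ZMod 2 => (Function.update p.1 i p.2, p.1 i))
      (Function.Involutive.bijective fun p => by simp) _ _ ?_
    rintro ⟨w, c⟩
    simp only [Function.update_self, Function.update_idem, Function.update_eq_self]
    have : ((U⁻¹ : Matrix.unitaryGroup (ZMod 2) ℂ) : Matrix (ZMod 2) (ZMod 2) ℂ) c (w i)
        = star ((U : Matrix (ZMod 2) (ZMod 2) ℂ) (w i) c) := rfl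
    rw [this]; ring
  | two i j h U =>
    have key : ∀ (A : ZMod 2 → ZMod 2 → ℂ), ∑ c, ∑ d, A c d = ∑ p : ZMod 2 × ZMod 2, A p.1 p.2 :=
      fun A => (Fintype.sum_prod_type' A).symm
    simp only [ip, LGate.inv, LGate.apply, key, star_sum, star_mul', Finset.sum_mul,
      Finset.mul_sum]
    rw [← Fintype.sum_prod_type', ← Fintype.sum_prod_type']
    refine Fintype.sum_bijective
      (fun p : (ι → ZMod 2) × (ZMod 2 × ZMod 2) =>
        (Function.update (Function.update p.1 i p.2.1) j p.2.2, (p.1 i, p.1 j)))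
      (Function.Involutive.bijective fun p => by
        refine Prod.ext ?_ ?_
        · simp [update_update_pair h]
        · simp [Function.update_of_ne h]) _ _ ?_
    rintro ⟨w, c, d⟩
    simp only [Function.update_self, Function.update_of_ne h,
      update_update_pair h, Function.update_eq_self]
    have : ((U⁻¹ : Matrix.unitaryGroup (ZMod 2 × ZMod 2) ℂ) :
          Matrix (ZMod 2 × ZMod 2) (ZMod 2 × ZMod 2) ℂ) (c, d) (w i, w j)
        = star ((U : Matrix (ZMod 2 × ZMod 2) (ZMod 2 × ZMod 2) ℂ) (w i, w j) (c, d)) := rfl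
    rw [this]; ring

namespace LCirc

lemma run_inv_run (C : LCirc ι) (ψ : Amp ι) : run (inv C) (run C ψ) = ψ := by
  induction C generalizing ψ with
  | nil => rfl
  | cons g C ih => simp [inv_cons, run_append, ih, LGate.apply_inv_apply]

lemma _root_.QuantumGL.LGate.inv_inv (g : LGate ι) : g.inv.inv = g := by
  cases g <;> simp [LGate.inv]

lemma inv_inv (C : LCirc ι) : inv (inv C) = C := by
  have : (LGate.inv ∘ LGate.inv : LGate ι → LGate ι) = id := funext LGate.inv_inv
  simp [inv, this]

lemma run_run_inv (C : LCirc ι) (ψ : Amp ι) : run C (run (inv C) ψ) = ψ := by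
  simpa [inv_inv] using run_inv_run (inv C) ψ

lemma inv_append (C D : LCirc ι) : inv (C ++ D) = inv D ++ inv C := by simp [inv]

lemma ip_run_left [Fintype ι] (C : LCirc ι) (ψ φ : Amp ι) :
    ip (run C ψ) φ = ip ψ (run (inv C) φ) := by
  induction C generalizing ψ φ with
  | nil => rfl
  | cons g C ih => simp [inv_cons, run_append, ih, LGate.ip_apply_left]

lemma ip_run_run [Fintype ι] (C : LCirc ι) (ψ φ : Amp ι) :
    ip (run C ψ) (run C φ) = ip ψ φ := by
  rw [ip_run_left, run_inv_run]

end LCirc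

lemma ip_self [Fintype ι] (ψ : Amp ι) : ip ψ ψ = ((∑ w, ‖ψ w‖ ^ 2 : ℝ) : ℂ) := by
  simp only [ip, Complex.ofReal_sum]
  refine Finset.sum_congr rfl fun w _ => ?_
  simpa using Complex.conj_mul' (ψ w)

lemma LCirc.sum_norm_run [Fintype ι] (C : LCirc ι) (ψ : Amp ι) :
    ∑ w, ‖C.run ψ w‖ ^ 2 = ∑ w, ‖ψ w‖ ^ 2 := by
  have := LCirc.ip_run_run C ψ ψ
  rw [ip_self, ip_self] at this
  exact_mod_cast this

lemma sum_norm_bket [Fintype ι] (s : ι → ZMod 2) : ∑ w, ‖bket s w‖ ^ 2 = 1 := by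
  rw [Finset.sum_eq_single s] <;> simp +contextual [bket]

lemma ip_bket_left [Fintype ι] (s : ι → ZMod 2) (φ : Amp ι) : ip (bket s) φ = φ s := by
  unfold ip
  rw [Finset.sum_eq_single s] <;> simp +contextual [bket]

lemma eq_sum_bket [Fintype ι] (ψ : Amp ι) : ψ = ∑ w, ψ w • bket w := by
  funext v
  simp [bket, Finset.sum_apply]

lemma LCirc.run_sum {α : Type} (C : LCirc ι) (s : Finset α) (F : α → Amp ι) :
    C.run (∑ a ∈ s, F a) = ∑ a ∈ s, C.run (F a) := by
  classical
  induction s using Finset.induction_on with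
  | empty => simp [LCirc.run_zero]
  | insert a s ha ih => simp [Finset.sum_insert ha, LCirc.run_add, ih]

lemma LCirc.run_apply_eq_sum [Fintype ι] (C : LCirc ι) (ψ : Amp ι) (v : ι → ZMod 2) :
    C.run ψ v = ∑ w, ψ w * C.run (bket w) v := by
  conv_lhs => rw [eq_sum_bket ψ]
  simp [LCirc.run_sum, LCirc.run_smul, Finset.sum_apply]

/-! ### Unaffected qubits -/

/-- Running `C` does not change the values of the qubits in `A`. -/
def LCirc.Keeps (C : LCirc ι) (A : Set ι) : Prop :=
  ∀ ψ w, C.run ψ w ≠ 0 → ∃ w', ψ w' ≠ 0 ∧ ∀ q ∈ A, w' q = w q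

lemma LCirc.Keeps.append {C D : LCirc ι} {A : Set ι} (hC : C.Keeps A) (hD : D.Keeps A) :
    LCirc.Keeps (C ++ D) A := by
  intro ψ w hw
  rw [LCirc.run_append] at hw
  obtain ⟨w', h1, h2⟩ := hD _ _ hw
  obtain ⟨w'', h3, h4⟩ := hC _ _ h1
  exact ⟨w'', h3, fun q hq => (h4 q hq).trans (h2 q hq)⟩

lemma LGate.exists_of_apply_ne_zero (g : LGate ι) {ψ : Amp ι} {w : ι → ZMod 2}
    (h : g.apply ψ w ≠ 0) : ∃ w', ψ w' ≠ 0 ∧ ∀ q ∉ g.touched, w' q = w q := by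
  cases g with
  | one i U =>
    obtain ⟨c, -, hc⟩ := Finset.exists_ne_zero_of_sum_ne_zero h
    refine ⟨_, right_ne_zero_of_mul hc, fun q hq => ?_⟩
    simp only [LGate.touched, Finset.mem_singleton] at hq
    simp [hq]
  | two i j hij U =>
    obtain ⟨c, -, hc⟩ := Finset.exists_ne_zero_of_sum_ne_zero h
    obtain ⟨d, -, hd⟩ := Finset.exists_ne_zero_of_sum_ne_zero hc
    refine ⟨_, right_ne_zero_of_mul hd, fun q hq => ?_⟩
    simp only [LGate.touched, Finset.mem_insert, Finset.mem_singleton, not_or] at hq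
    simp [hq.1, hq.2]

lemma LCirc.keeps_of_disjoint (C : LCirc ι) {A : Set ι} (h : ∀ q ∈ A, q ∉ C.touched) :
    C.Keeps A := by
  induction C with
  | nil => exact fun ψ w hw => ⟨w, hw, fun _ _ => rfl⟩
  | cons g C ih =>
    have h1 : LCirc.Keeps [g] A := by
      intro ψ w hw
      obtain ⟨w', h1, h2⟩ := g.exists_of_apply_ne_zero (show g.apply ψ w ≠ 0 from hw)
      exact ⟨w', h1, fun q hq => h2 q fun h' => h q hq (by simp [h'])⟩
    exact h1.append (ih fun q hq h' => h q hq (by simp [h']))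

@[simp] lemma LGate.touched_inv (g : LGate ι) : g.inv.touched = g.touched := by cases g <;> rfl

lemma LCirc.touched_append (C D : LCirc ι) :
    LCirc.touched (C ++ D) = C.touched ∪ D.touched := by
  induction C with
  | nil => simp
  | cons g C ih => simp [ih]

@[simp] lemma LCirc.touched_inv (C : LCirc ι) : C.inv.touched = C.touched := by
  induction C with
  | nil => rfl
  | cons g C ih => simp [LCirc.inv_cons, LCirc.touched_append, ih, Finset.union_comm]

/-- A circuit commutes with flipping a qubit on which it does not act. -/
lemma LCirc.run_flip (C : LCirc ι) {q : ι} (hq : q ∉ C.touched) (ψ : Amp ι) (w : ι → ZMod 2) :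
    C.run (fun v => ψ (v + Pi.single q 1)) w = C.run ψ (w + Pi.single q 1) := by
  have upd : ∀ (v : ι → ZMod 2) (i : ι) (c : ZMod 2), q ≠ i →
      Function.update v i c + Pi.single q 1 = Function.update (v + Pi.single q 1) i c := by
    intro v i c hi
    funext r
    by_cases h : r = i
    · subst h; simp [Pi.single_eq_of_ne hi.symm]
    · simp [h]
  induction C generalizing ψ with
  | nil => rfl
  | cons g C ih =>
    simp only [LCirc.touched_cons, Finset.mem_union, not_or] at hq
    rw [LCirc.run_cons, LCirc.run_cons, ← ih hq.2]
    congr 1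
    funext v
    cases g with
    | one i U =>
      have hi : q ≠ i := by simpa [LGate.touched] using hq.1
      simp [LGate.apply, upd _ _ _ hi, Pi.single_eq_of_ne hi.symm]
    | two i j hij U =>
      have hi : q ≠ i ∧ q ≠ j := by simpa [LGate.touched] using hq.1
      simp [LGate.apply, upd _ _ _ hi.1, upd _ _ _ hi.2, Pi.single_eq_of_ne hi.1.symm,
        Pi.single_eq_of_ne hi.2.symm]

/-! ### Relabelling -/

lemma extend_update_comp (e : κ ↪ ι) (w : ι → ZMod 2) (i : κ) (c : ZMod 2) (u : κ → ZMod 2) :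
    Function.extend e (Function.update u i c) w
      = Function.update (Function.extend e u w) (e i) c := by
  funext q
  by_cases h : ∃ j, e j = q
  · obtain ⟨j, rfl⟩ := h
    rw [e.injective.extend_apply]
    by_cases hj : j = i
    · subst hj; simp
    · rw [Function.update_of_ne hj, Function.update_of_ne (fun h => hj (e.injective h)),
        e.injective.extend_apply]
  · have h' : q ≠ e i := fun h' => h ⟨i, h'.symm⟩
    rw [Function.extend_apply' _ _ _ h, Function.update_of_ne h', Function.extend_apply' _ _ _ h]

lemma extend_comp_self (e : κ ↪ ι) (w : ι → ZMod 2) : Function.extend e (w ∘ e) w = w := by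
  funext q
  by_cases h : ∃ j, e j = q
  · obtain ⟨j, rfl⟩ := h
    rw [e.injective.extend_apply]; rfl
  · rw [Function.extend_apply' _ _ _ h]

lemma extend_extend_base (e : κ ↪ ι) (u v : κ → ZMod 2) (w : ι → ZMod 2) :
    Function.extend e u (Function.extend e v w) = Function.extend e u w := by
  funext q
  by_cases h : ∃ j, e j = q
  · obtain ⟨j, rfl⟩ := h
    simp [e.injective.extend_apply]
  · simp [Function.extend_apply' _ _ _ h]

/-- Qubits outside the range of `e` are spectators: once their values in `w` are fixed, the gate
acts on the slice `u ↦ ψ (extend e u w)`. -/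
lemma LGate.apply_map (e : κ ↪ ι) (g : LGate κ) (ψ : Amp ι) (w : ι → ZMod 2) :
    (g.map e).apply ψ w = g.apply (fun u => ψ (Function.extend e u w)) (w ∘ e) := by
  cases g <;>
  simp [LGate.map, LGate.apply, extend_update_comp, extend_comp_self]

lemma LCirc.run_emb (e : κ ↪ ι) (C : LCirc κ) (ψ : Amp ι) (w : ι → ZMod 2) :
    (C.emb e).run ψ w = C.run (fun u => ψ (Function.extend e u w)) (w ∘ e) := by
  induction C generalizing ψ with
  | nil => simp [LCirc.emb, extend_comp_self]
  | cons g C ih =>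
    have h : LCirc.emb e (g :: C) = g.map e :: LCirc.emb e C := rfl
    rw [h, LCirc.run_cons, LCirc.run_cons, ih]
    congr 1
    funext u
    rw [LGate.apply_map]
    simp only [extend_extend_base]
    congr 1
    funext q
    simp [e.injective.extend_apply]

lemma LCirc.touched_emb (e : κ ↪ ι) (C : LCirc κ) : (C.emb e).touched = C.touched.map e := by
  induction C with
  | nil => rfl
  | cons g C ih =>
    have h : LCirc.emb e (g :: C) = g.map e :: LCirc.emb e C := rfl
    rw [h, LCirc.touched_cons, ih, LCirc.touched_cons, Finset.map_union]
    congr 1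
    cases g <;> simp [LGate.map, LGate.touched]

end Basic

/-! ### Signs -/

/-- The sign `(-1)^a`. -/
noncomputable def sgn (a : ZMod 2) : ℂ := if a = 0 then 1 else -1

@[simp] lemma sgn_zero : sgn 0 = 1 := by simp [sgn]
@[simp] lemma sgn_one : sgn 1 = -1 := by simp [sgn]

lemma zmod_two_cases (a : ZMod 2) : a = 0 ∨ a = 1 := by
  revert a; decide

lemma zmod_two_add_self (a : ZMod 2) : a + a = 0 := by
  revert a; decide

lemma sgn_add (a b : ZMod 2) : sgn (a + b) = sgn a * sgn b := by
  rcases zmod_two_cases a with rfl | rfl <;> rcases zmod_two_cases b with rfl | rfl <;>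
    simp [show (1 + 1 : ZMod 2) = 0 from rfl]

lemma sgn_mul_self (a : ZMod 2) : sgn a * sgn a = 1 := by
  rw [← sgn_add, zmod_two_add_self, sgn_zero]

lemma star_sgn (a : ZMod 2) : star (sgn a) = sgn a := by
  rcases zmod_two_cases a with rfl | rfl <;> simp

lemma sgn_sum {α : Type} (s : Finset α) (f : α → ZMod 2) :
    sgn (∑ i ∈ s, f i) = ∏ i ∈ s, sgn (f i) := by
  classical
  induction s using Finset.induction_on with
  | empty => simp
  | insert a s ha ih => rw [Finset.sum_insert ha, Finset.prod_insert ha, sgn_add, ih]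

lemma sum_zmod_two (f : ZMod 2 → ℂ) : ∑ c, f c = f 0 + f 1 := Fin.sum_univ_two f

/-! ### Elementary gates -/

/-- The unitary matrix of a permutation of the basis. -/
def permU {α : Type} [Fintype α] [DecidableEq α] (π : Equiv.Perm α) : Matrix.unitaryGroup α ℂ :=
  ⟨Matrix.of fun a b => if b = π a then 1 else 0, by
    rw [Matrix.mem_unitaryGroup_iff]
    ext a b
    rw [Matrix.mul_apply, Matrix.one_apply, Finset.sum_eq_single (π a)]
    · simp [Matrix.star_apply]
    · intro c _ hc; simp [hc]
    · simp⟩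

/-- A diagonal unitary matrix. -/
noncomputable def diagU {α : Type} [Fintype α] [DecidableEq α] (d : α → ℂ)
    (hd : ∀ a, d a * star (d a) = 1) : Matrix.unitaryGroup α ℂ :=
  ⟨Matrix.diagonal d, by
    rw [Matrix.mem_unitaryGroup_iff, Matrix.star_eq_conjTranspose, Matrix.diagonal_conjTranspose,
      Matrix.diagonal_mul_diagonal, ← Matrix.diagonal_one]
    congr 1
    funext a
    exact hd a⟩

/-- The real number `1/√2` as a complex number. -/
noncomputable def rt : ℂ := ((√2)⁻¹ : ℝ)

lemma rt_mul_rt : rt * rt = 1 / 2 := by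
  unfold rt
  rw [← Complex.ofReal_mul, ← mul_inv, Real.mul_self_sqrt (by norm_num)]
  norm_num

lemma star_rt : star rt = rt := Complex.conj_ofReal _

/-- The Hadamard matrix. -/
noncomputable def hadU : Matrix.unitaryGroup (ZMod 2) ℂ :=
  ⟨Matrix.of fun a b => rt * sgn (a * b), by
    rw [Matrix.mem_unitaryGroup_iff]
    ext a b
    rw [Matrix.mul_apply, Matrix.one_apply, sum_zmod_two]
    rcases zmod_two_cases a with rfl | rfl <;> rcases zmod_two_cases b with rfl | rfl <;>
      simp [Matrix.star_apply, star_rt, rt_mul_rt] <;> norm_num⟩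

section Gates

variable {ι : Type} [DecidableEq ι]

/-- The Hadamard gate. -/
noncomputable def had (q : ι) : LGate ι := .one q hadU

lemma had_apply (q : ι) (ψ : Amp ι) (w : ι → ZMod 2) :
    (had q).apply ψ w = ∑ c, rt * sgn (w q * c) * ψ (Function.update w q c) := rfl

/-- The Pauli gate `X`. -/
def notG (q : ι) : LGate ι := .one q (permU (Equiv.addRight 1))

lemma notG_apply (q : ι) (ψ : Amp ι) (w : ι → ZMod 2) :
    (notG q).apply ψ w = ψ (Function.update w q (w q + 1)) := by
  simp only [notG, LGate.apply, permU, Matrix.of_apply, Equiv.coe_addRight]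
  rw [Finset.sum_eq_single (w q + 1)] <;> simp +contextual

/-- The Pauli gate `Z`. -/
noncomputable def zG (q : ι) : LGate ι :=
  .one q (diagU sgn fun a => by rw [star_sgn, sgn_mul_self])

lemma zG_apply (q : ι) (ψ : Amp ι) (w : ι → ZMod 2) :
    (zG q).apply ψ w = sgn (w q) * ψ w := by
  simp [zG, LGate.apply, diagU, Matrix.diagonal_apply]

/-- The permutation `(x, y) ↦ (x, y + x + c)`. -/
def shearPerm (c : ZMod 2) : Equiv.Perm (ZMod 2 × ZMod 2) :=
  Function.Involutive.toPerm (fun p => (p.1, p.2 + (p.1 + c))) (fun p => by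
    refine Prod.ext rfl ?_
    show p.2 + (p.1 + c) + (p.1 + c) = p.2
    rw [add_assoc, zmod_two_add_self, add_zero])

/-- The controlled-not gate (`c = 0`), or the same with a negated control (`c = 1`). -/
def cx (c : ZMod 2) (a t : ι) (h : a ≠ t) : LGate ι := .two a t h (permU (shearPerm c))

lemma cx_apply (c : ZMod 2) (a t : ι) (h : a ≠ t) (ψ : Amp ι) (w : ι → ZMod 2) :
    (cx c a t h).apply ψ w = ψ (Function.update w t (w t + (w a + c))) := by
  have hs : ∀ x y, shearPerm c (x, y) = (x, y + (x + c)) := fun _ _ => rfl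
  simp only [cx, LGate.apply, permU, Matrix.of_apply, hs]
  rw [Finset.sum_eq_single (w a), Finset.sum_eq_single (w t + (w a + c))]
  · simp
  · intro d _ hd
    rw [if_neg, zero_mul]
    simp [hd]
  · simp
  · intro d _ hd
    refine Finset.sum_eq_zero fun d' _ => ?_
    rw [if_neg, zero_mul]
    simp [hd]
  · simp

/-- The phase `z^(xy)` on bits `x`, `y`. -/
noncomputable def ph (z : ℂ) (p : ZMod 2 × ZMod 2) : ℂ := if p.1 = 1 ∧ p.2 = 1 then z else 1

/-- The controlled phase gate. -/
noncomputable def cphase (z : ℂ) (hz : z * star z = 1) (a t : ι) (h : a ≠ t) : LGate ι :=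
  .two a t h (diagU (ph z) fun p => by unfold ph; split_ifs <;> simp_all)

lemma cphase_apply (z : ℂ) (hz : z * star z = 1) (a t : ι) (h : a ≠ t) (ψ : Amp ι)
    (w : ι → ZMod 2) : (cphase z hz a t h).apply ψ w = ph z (w a, w t) * ψ w := by
  simp only [cphase, LGate.apply, diagU]
  rw [Finset.sum_eq_single (w a), Finset.sum_eq_single (w t)]
  · simp
  · intro d _ hd; simp [hd.symm]
  · simp
  · intro d _ hd; simp [hd.symm]
  · simp

lemma unit_I : Complex.I * star Complex.I = 1 := by simp
lemma unit_neg_I : (-Complex.I) * star (-Complex.I) = 1 := by simp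

/-- The Toffoli gate with controls `a`, `b` and target `t` (empty if these are not distinct). -/
noncomputable def toffoli (a b t : ι) : LCirc ι :=
  if h : a ≠ b ∧ b ≠ t ∧ a ≠ t then
    [had t, cphase Complex.I unit_I b t h.2.1, cx 0 a b h.1,
      cphase (-Complex.I) unit_neg_I b t h.2.1, cx 0 a b h.1,
      cphase Complex.I unit_I a t h.2.2, had t]
  else []

lemma length_toffoli_le (a b t : ι) : (toffoli a b t).length ≤ 7 := by
  unfold toffoli; split_ifs <;> simp

/-- As integers, x + y - (x xor y) = 2xy, and i² = -1: this is the usual construction of a doubly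
controlled sign from singly controlled phases. -/
lemma ph_identity (x y z : ZMod 2) :
    ph Complex.I (x, z) * (ph (-Complex.I) (y + x, z) * ph Complex.I (y, z)) =
      sgn (x * y * z) := by
  rcases zmod_two_cases x with rfl | rfl <;> rcases zmod_two_cases y with rfl | rfl <;>
    rcases zmod_two_cases z with rfl | rfl <;>
    simp [ph, show (1 + 1 : ZMod 2) = 0 from rfl]

/-- The gates between the two Hadamards multiply by the sign of `w a * w b * w t`, by `ph_identity`;
conjugation by a Hadamard on the target turns this sign into an addition to the target. -/
lemma run_toffoli {a b t : ι} (hab : a ≠ b) (hbt : b ≠ t) (hat : a ≠ t) (ψ : Amp ι)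
    (w : ι → ZMod 2) :
    (toffoli a b t).run ψ w = ψ (Function.update w t (w t + w a * w b)) := by
  rw [toffoli, dif_pos ⟨hab, hbt, hat⟩]
  simp only [LCirc.run_cons, LCirc.run_nil, had_apply, cphase_apply, cx_apply,
    Function.update_self, Function.update_of_ne hab,
    Function.update_of_ne hbt, Function.update_of_ne hbt.symm, Function.update_of_ne hat,
    Function.update_idem, add_zero]
  have e1 : ∀ c d : ZMod 2, Function.update (Function.update (Function.update w t c) b
      (w b)) t d = Function.update w t d := by
    intro c d
    have : Function.update (Function.update w t c) b (w b) = Function.update w t c := by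
      rw [Function.update_eq_self_iff, Function.update_of_ne hbt]
    rw [this, Function.update_idem]
  have e2 : w b + w a + w a = w b := by rw [add_assoc, zmod_two_add_self, add_zero]
  simp only [e2]
  simp only [e1]
  have e3 : ∀ c : ZMod 2, ∀ S : ℂ,
      ph Complex.I (w a, c) * (ph (-Complex.I) (w b + w a, c) * (ph Complex.I (w b, c) * S))
        = sgn (w a * w b * c) * S := by
    intro c S
    rw [← ph_identity]; ring
  simp only [e3, sum_zmod_two]
  have hr := rt_mul_rt
  generalize hA : ψ (Function.update w t 0) = A
  generalize hB : ψ (Function.update w t 1) = B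
  rcases zmod_two_cases (w t) with ht | ht <;> rcases zmod_two_cases (w a) with h1 | h1 <;>
    rcases zmod_two_cases (w b) with h2 | h2 <;>
    simp only [ht, h1, h2, mul_zero, mul_one, one_mul, add_zero, zero_add, sgn_zero,
      sgn_one, hA, hB, show (1 + 1 : ZMod 2) = 0 from rfl] <;>
    first | linear_combination (2 * A) * hr | linear_combination (2 * B) * hr

end Gates

/-! ### Layers of controlled additions and multiply controlled signs -/

section Layers

variable {ι : Type} [DecidableEq ι] {α : Type}

/-- The string obtained from `w` by adding `v i w` to the qubit `t i` for every `i ∈ S`. -/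
def xorMap (t : α → ι) (v : α → (ι → ZMod 2) → ZMod 2) (S : Finset α) (w : ι → ZMod 2) :
    ι → ZMod 2 := fun q => w q + ∑ i ∈ S, if t i = q then v i w else 0

/-- Adding `v i w` to the qubit `t i`, for all `i ∈ S`. -/
noncomputable def layer (g : α → LGate ι) (S : Finset α) : LCirc ι := S.toList.map g

@[simp] lemma length_layer (g : α → LGate ι) (S : Finset α) : (layer g S).length = S.card := by
  simp [layer]

/-- A family of gates that add `v i w` to the qubits `t i`, where `v i w` does not depend on these
qubits. -/
structure XorFamily (g : α → LGate ι) (t : α → ι) (v : α → (ι → ZMod 2) → ZMod 2) : Prop where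
  apply : ∀ i ψ w, (g i).apply ψ w = ψ (Function.update w (t i) (w (t i) + v i w))
  indep : ∀ i j w c, v i (Function.update w (t j) c) = v i w
  inj : Function.Injective t

variable {g : α → LGate ι} {t : α → ι} {v : α → (ι → ZMod 2) → ZMod 2}

lemma xorMap_target (h : Function.Injective t) {S : Finset α} {i : α} (hi : i ∈ S)
    (w : ι → ZMod 2) : xorMap t v S w (t i) = w (t i) + v i w := by
  classical
  simp [xorMap, h.eq_iff, hi]

lemma xorMap_of_notMem (h : Function.Injective t) {S : Finset α} {i : α} (hi : i ∉ S)
    (w : ι → ZMod 2) : xorMap t v S w (t i) = w (t i) := by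
  classical
  simp [xorMap, h.eq_iff, hi]

lemma xorMap_other {S : Finset α} {q : ι} (hq : ∀ i, t i ≠ q)
    (w : ι → ZMod 2) : xorMap t v S w q = w q := by
  simp [xorMap, hq]

namespace XorFamily

lemma run_map (h : XorFamily g t v) (L : List α) (ψ : Amp ι) (w : ι → ZMod 2) :
    LCirc.run (L.map g) ψ w
      = ψ (fun q => w q + (L.map fun i => if t i = q then v i w else 0).sum) := by
  -- Earlier additions do not alter the values added later, so the gates of the list act
  -- simultaneously.
  have hv : ∀ (L : List α) (i : α) (w : ι → ZMod 2),
      v i (fun q => w q + (L.map fun i => if t i = q then v i w else 0).sum) = v i w := by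
    intro L i w
    induction L with
    | nil => simp
    | cons j L ih =>
      have : (fun q => w q + (List.map (fun i => if t i = q then v i w else 0) (j :: L)).sum)
          = Function.update
              (fun q => w q + (L.map fun i => if t i = q then v i w else 0).sum) (t j)
              (w (t j) + (v j w + (L.map fun i => if t i = t j then v i w else 0).sum)) := by
        funext q
        by_cases hq : q = t j
        · subst hq; simp
        · simp [hq, Ne.symm hq]
      rw [this, h.indep, ih]
  induction L generalizing ψ with
  | nil => simp
  | cons j L ih =>
    rw [List.map_cons, LCirc.run_cons, ih, h.apply, hv]
    congr 1
    funext q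
    by_cases hq : q = t j
    · subst hq; simp; ring
    · simp [hq, Ne.symm hq]

lemma run (h : XorFamily g t v) (S : Finset α) (ψ : Amp ι) (w : ι → ZMod 2) :
    LCirc.run (layer g S) ψ w = ψ (xorMap t v S w) := by
  rw [layer, h.run_map]
  congr 1
  funext q
  rw [Finset.sum_map_toList]; rfl

lemma val_xorMap (h : XorFamily g t v) (S : Finset α) (i : α) (w : ι → ZMod 2) :
    v i (xorMap t v S w) = v i w := by
  classical
  have : ∀ S : Finset α,
      v i (fun q => w q + ∑ i ∈ S, if t i = q then v i w else 0) = v i w := by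
    intro S
    induction S using Finset.induction_on with
    | empty => simp
    | insert j S hj ih =>
      have : (fun q => w q + ∑ i ∈ insert j S, if t i = q then v i w else 0)
          = Function.update (fun q => w q + ∑ i ∈ S, if t i = q then v i w else 0) (t j)
              (w (t j) + (v j w + ∑ i ∈ S, if t i = t j then v i w else 0)) := by
        funext q
        by_cases hq : q = t j
        · subst hq; simp [Finset.sum_insert hj]
        · simp [hq, Ne.symm hq, Finset.sum_insert hj]
      rw [this, h.indep, ih]
  exact this S

lemma xorMap_xorMap (h : XorFamily g t v) (S : Finset α) (w : ι → ZMod 2) :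
    xorMap t v S (xorMap t v S w) = w := by
  funext q
  have : xorMap t v S (xorMap t v S w) q
      = xorMap t v S w q + ∑ i ∈ S, if t i = q then v i w else 0 := by
    conv_lhs => unfold xorMap
    congr 1
    refine Finset.sum_congr rfl fun i _ => ?_
    rw [← h.val_xorMap S i w]; rfl
  rw [this, xorMap, add_assoc, zmod_two_add_self, add_zero]

lemma run_inv (h : XorFamily g t v) (S : Finset α) (ψ : Amp ι) (w : ι → ZMod 2) :
    LCirc.run (LCirc.inv (layer g S)) ψ w = ψ (xorMap t v S w) := by
  have h1 : LCirc.run (layer g S) (fun w => ψ (xorMap t v S w)) = ψ := by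
    funext w
    rw [h.run, h.xorMap_xorMap]
  conv_lhs => rw [← h1]
  rw [LCirc.run_inv_run]

lemma keeps (h : XorFamily g t v) (S : Finset α) {A : Set ι} (hA : ∀ i ∈ S, t i ∉ A) :
    LCirc.Keeps (layer g S) A := by
  intro ψ w hw
  rw [h.run] at hw
  refine ⟨_, hw, fun q hq => ?_⟩
  rw [xorMap, Finset.sum_eq_zero, add_zero]
  intro i hi
  rw [if_neg]
  rintro rfl
  exact hA i hi hq

lemma keeps_inv (h : XorFamily g t v) (S : Finset α) {A : Set ι} (hA : ∀ i ∈ S, t i ∉ A) :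
    LCirc.Keeps (LCirc.inv (layer g S)) A := by
  intro ψ w hw
  rw [h.run_inv, ← h.run S ψ] at hw
  exact h.keeps S hA ψ w hw

/-- Conjugating a diagonal operator by a layer. -/
lemma run_conj (h : XorFamily g t v) (S : Finset α) {D : LCirc ι} {d : (ι → ZMod 2) → ℂ}
    {ψ : Amp ι} (hD : ∀ w, D.run (fun w => ψ (xorMap t v S w)) w = d w * ψ (xorMap t v S w))
    (w : ι → ZMod 2) :
    LCirc.run (layer g S ++ D ++ LCirc.inv (layer g S)) ψ w = d (xorMap t v S w) * ψ w := by
  have h1 : LCirc.run (layer g S) ψ = fun w => ψ (xorMap t v S w) := funext (h.run S ψ)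
  rw [LCirc.run_append, LCirc.run_append, h.run_inv, h1, hD, h.xorMap_xorMap]

end XorFamily

lemma xorFamily_notG : XorFamily (notG : ι → LGate ι) id (fun _ _ => 1) where
  apply i ψ w := notG_apply i ψ w
  indep _ _ _ _ := rfl
  inj := Function.injective_id

lemma xorFamily_cx (c : ZMod 2) (a t : α → ι) (h : ∀ i j, a i ≠ t j) (ht : Function.Injective t) :
    XorFamily (fun i => cx c (a i) (t i) (h i i)) t (fun i w => w (a i) + c) where
  apply i ψ w := cx_apply _ _ _ _ ψ w
  indep i j w c := by simp [Function.update_of_ne (h i j)]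
  inj := ht

/-! ### Multiply controlled signs -/

/-- A circuit for the sign `-1` on strings with ones at `c` and at all qubits of `L`; the qubit
`anc q` is auxiliary for `q ∈ L`. -/
noncomputable def ladder (anc : ι → ι) : ι → List ι → LCirc ι
  | c, [] => [zG c]
  | c, q :: L => toffoli c q (anc q) ++ ladder anc (anc q) L ++ toffoli c q (anc q)

lemma length_ladder_le (anc : ι → ι) (c : ι) (L : List ι) :
    (ladder anc c L).length ≤ 14 * L.length + 1 := by
  induction L generalizing c with
  | nil => simp [ladder]
  | cons q L ih =>
    have h1 := length_toffoli_le c q (anc q)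
    have h2 := ih (anc q)
    simp only [ladder, List.length_append, List.length_cons]
    omega

/-- The first Toffoli writes the conjunction of `c` and `q` into `anc q`, which is the control of
the remaining ladder, and the last Toffoli erases it. Because the ancillas vanish on the support of
`ψ`, the written bit is exactly the conjunction. -/
lemma run_ladder (anc : ι → ι) (c : ι) (L : List ι) (hL : L.Nodup) (hc : c ∉ L)
    (hca : ∀ q ∈ L, anc q ≠ c) (haL : ∀ q ∈ L, ∀ q' ∈ L, anc q ≠ q')
    (hinj : ∀ q ∈ L, ∀ q' ∈ L, anc q = anc q' → q = q')
    (ψ : Amp ι) (hψ : ∀ w, ψ w ≠ 0 → ∀ q ∈ L, w (anc q) = 0) (w : ι → ZMod 2) :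
    (ladder anc c L).run ψ w = sgn (w c * (L.map w).prod) * ψ w := by
  induction L generalizing c ψ w with
  | nil => simp [ladder, zG_apply]
  | cons q L ih =>
    simp only [List.mem_cons, not_or, List.nodup_cons] at *
    have hcq : c ≠ q := hc.1
    have hqa : q ≠ anc q := (haL q (Or.inl rfl) q (Or.inl rfl)).symm
    have hcanc : c ≠ anc q := (hca q (Or.inl rfl)).symm
    set T : (ι → ZMod 2) → (ι → ZMod 2) :=
      fun w => Function.update w (anc q) (w (anc q) + w c * w q) with hT
    have hφ : (toffoli c q (anc q)).run ψ = fun w => ψ (T w) :=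
      funext fun w => run_toffoli hcq hqa hcanc ψ w
    have hTT : ∀ w, T (T w) = w := by
      intro w
      simp only [hT, Function.update_self, Function.update_of_ne hcanc, Function.update_of_ne hqa,
        Function.update_idem, add_assoc, zmod_two_add_self, add_zero, Function.update_eq_self]
    have key := ih (anc q) hL.2
      (fun h => (haL q (Or.inl rfl) (anc q) (Or.inr h)) rfl)
      (fun q' hq' h => hL.1 (by
        rwa [← hinj q' (Or.inr hq') q (Or.inl rfl) h]))
      (fun q' hq' q'' hq'' => haL q' (Or.inr hq') q'' (Or.inr hq''))
      (fun q' hq' q'' hq'' => hinj q' (Or.inr hq') q'' (Or.inr hq''))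
      (fun w => ψ (T w))
      (fun w hw q' hq' => by
        have h1 := hψ _ hw q' (Or.inr hq')
        have h2 : anc q' ≠ anc q := fun h => hL.1 (by
          rwa [← hinj q' (Or.inr hq') q (Or.inl rfl) h])
        simpa [hT, h2] using h1)
    rw [ladder, LCirc.run_append, LCirc.run_append, hφ, run_toffoli hcq hqa hcanc]
    change (ladder anc (anc q) L).run (fun w => ψ (T w)) (T w) = _
    rw [key, hTT]
    by_cases h0 : ψ w = 0
    · simp [h0]
    · have h1 := hψ w h0 q (Or.inl rfl)
      have h2 : L.map (T w) = L.map w := by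
        refine List.map_congr_left fun q' hq' => ?_
        simp [hT, (haL q (Or.inl rfl) q' (Or.inr hq')).symm]
      rw [h2, List.map_cons, List.prod_cons]
      simp [hT, h1, mul_assoc]

lemma zmod_two_prod_eq_one {α : Type} (S : Finset α) (f : α → ZMod 2) :
    ∏ i ∈ S, f i = if ∀ i ∈ S, f i = 1 then 1 else 0 := by
  split_ifs with h
  · exact Finset.prod_eq_one h
  · push Not at h
    obtain ⟨i, hi, h⟩ := h
    exact Finset.prod_eq_zero hi ((zmod_two_cases _).resolve_right h)

/-- The auxiliary qubits `anc q`, `q ∈ S`, can be used for a sign controlled by `c` and `S`. -/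
structure AncFor (anc : ι → ι) (c : ι) (S : Finset ι) : Prop where
  notMem : c ∉ S
  ne : ∀ q ∈ S, anc q ≠ c
  ne' : ∀ q ∈ S, ∀ q' ∈ S, anc q ≠ q'
  inj : ∀ q ∈ S, ∀ q' ∈ S, anc q = anc q' → q = q'

lemma AncFor.run_ladder {anc : ι → ι} {c : ι} {S : Finset ι} (h : AncFor anc c S)
    (ψ : Amp ι) (hψ : ∀ w, ψ w ≠ 0 → ∀ q ∈ S, w (anc q) = 0) (w : ι → ZMod 2) :
    (ladder anc c S.toList).run ψ w = (if ∀ q ∈ insert c S, w q = 1 then -1 else 1) * ψ w := by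
  rw [QuantumGL.run_ladder anc c S.toList S.nodup_toList (by simpa using h.notMem)
    (by simpa using h.ne) (by simpa using h.ne') (by simpa using h.inj) ψ (by simpa using hψ),
    Finset.prod_map_toList, ← Finset.prod_insert h.notMem, zmod_two_prod_eq_one]
  split_ifs <;> simp

/-- The reflection that changes the sign of the strings that vanish on `insert c S`. -/
noncomputable def zeroRefl (anc : ι → ι) (c : ι) (S : Finset ι) : LCirc ι :=
  layer notG (insert c S) ++ ladder anc c S.toList ++ LCirc.inv (layer notG (insert c S))

lemma AncFor.run_zeroRefl {anc : ι → ι} {c : ι} {S : Finset ι} (h : AncFor anc c S)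
    (ψ : Amp ι) (hψ : ∀ w, ψ w ≠ 0 → ∀ q ∈ S, w (anc q) = 0) (w : ι → ZMod 2) :
    (zeroRefl anc c S).run ψ w = (if ∀ q ∈ insert c S, w q = 0 then -1 else 1) * ψ w := by
  have hn : ∀ (w : ι → ZMod 2), ∀ q ∈ insert c S,
      xorMap id (fun _ _ => 1) (insert c S) w q = w q + 1 :=
    fun w q hq => xorMap_target (t := id) (v := fun _ _ => 1) Function.injective_id hq w
  have hn' : ∀ (w : ι → ZMod 2), ∀ q ∉ insert c S,
      xorMap id (fun _ _ => 1) (insert c S) w q = w q :=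
    fun w q hq => xorMap_of_notMem (t := id) (v := fun _ _ => 1) Function.injective_id hq w
  rw [zeroRefl, xorFamily_notG.run_conj
    (d := fun w => if ∀ q ∈ insert c S, w q = 1 then -1 else 1)]
  · congr 2
    refine propext (forall₂_congr fun q hq => ?_)
    rw [hn w q hq]
    rcases zmod_two_cases (w q) with h | h <;> simp [h, show (1 + 1 : ZMod 2) = 0 from rfl]
  · intro w
    rw [h.run_ladder]
    intro w hw q hq
    have := hψ _ hw q hq
    rwa [hn'] at this
    simp only [Finset.mem_insert, not_or]
    exact ⟨h.ne q hq, fun h' => h.ne' q hq _ h' rfl⟩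

/-- The sign `-1` on strings `w` with `w c = 1` and `w (t i) = w (a i)` for all `i ∈ S`. -/
noncomputable def eqSign (anc : ι → ι) (c : ι) (a t : α → ι) (h : ∀ i j, a i ≠ t j) [DecidableEq α]
    (S : Finset α) : LCirc ι :=
  layer (fun i => cx 1 (a i) (t i) (h i i)) S ++ ladder anc c (S.image t).toList ++
    LCirc.inv (layer (fun i => cx 1 (a i) (t i) (h i i)) S)

/-- The gates with negated control add `w (a i) + 1` to the target, which becomes 1 exactly when the
two bits agree. Equality is thus turned into a conjunction for the ladder. -/
lemma AncFor.run_eqSign [DecidableEq α] {anc : ι → ι} {c : ι} {a t : α → ι}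
    (h : ∀ i j, a i ≠ t j) (ht : Function.Injective t) {S : Finset α}
    (hc : AncFor anc c (S.image t)) (hct : ∀ i, t i ≠ c) (hanc : ∀ i ∈ S, ∀ j, t j ≠ anc (t i))
    (ψ : Amp ι) (hψ : ∀ w, ψ w ≠ 0 → ∀ i ∈ S, w (anc (t i)) = 0) (w : ι → ZMod 2) :
    (eqSign anc c a t h S).run ψ w
      = (if w c = 1 ∧ ∀ i ∈ S, w (t i) = w (a i) then -1 else 1) * ψ w := by
  rw [eqSign, (xorFamily_cx 1 a t h ht).run_conj
    (d := fun w => if ∀ q ∈ insert c (S.image t), w q = 1 then -1 else 1)]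
  · congr 2
    refine propext ?_
    simp only [Finset.forall_mem_insert, Finset.forall_mem_image]
    rw [xorMap_other hct]
    refine and_congr Iff.rfl (forall₂_congr fun i hi => ?_)
    rw [xorMap_target ht hi]
    rcases zmod_two_cases (w (t i)) with h | h <;> rcases zmod_two_cases (w (a i)) with h' | h' <;>
      simp [h, h', show (1 + 1 : ZMod 2) = 0 from rfl]
  · intro w
    rw [hc.run_ladder]
    intro w hw q hq
    obtain ⟨i, hi, rfl⟩ := Finset.mem_image.mp hq
    have := hψ _ hw i hi
    rwa [xorMap_other] at this
    exact fun j => hanc i hi j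

/-! ### Layers of Hadamard gates -/

lemma run_had_list [Fintype ι] (Q : List ι) (hQ : Q.Nodup) (w v : ι → ZMod 2) :
    LCirc.run (Q.map had) (bket w) v
      = if ∀ q ∉ Q, v q = w q then (Q.map fun q => rt * sgn (v q * w q)).prod else 0 := by
  induction Q generalizing w with
  | nil => simp [bket, funext_iff]
  | cons q Q ih =>
    rw [List.nodup_cons] at hQ
    have h1 : (had q).apply (bket w)
        = ∑ c, (rt * sgn (c * w q)) • bket (Function.update w q c) := by
      funext x
      rw [had_apply, Finset.sum_apply]
      have e : ∀ c, (bket w (Function.update x q c) : ℂ) =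
          if c = w q ∧ ∀ r, r ≠ q → x r = w r then 1 else 0 := by
        intro c
        simp only [bket]
        congr 1
        refine propext ?_
        rw [Function.update_eq_iff]
      have e' : ∀ c, (bket (Function.update w q c) x : ℂ) =
          if x q = c ∧ ∀ r, r ≠ q → x r = w r then 1 else 0 := by
        intro c
        simp only [bket]
        congr 1
        refine propext ?_
        rw [Function.eq_update_iff]
      simp only [Pi.smul_apply, smul_eq_mul, e, e']
      by_cases hx : ∀ r, r ≠ q → x r = w r
      · simp only [and_iff_left hx]
        simp
      · simp only [hx, and_false, if_false, mul_zero, Finset.sum_const_zero]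
    -- The remaining gates do not act on `q`, so only the branch in which this bit already equals `v
    -- q` contributes.
    rw [List.map_cons, LCirc.run_cons, h1, LCirc.run_sum, Finset.sum_apply,
      Finset.sum_eq_single (v q)]
    · rw [LCirc.run_smul, Pi.smul_apply, ih hQ.2, smul_eq_mul]
      have hmap : (Q.map fun r => rt * sgn (v r * Function.update w q (v q) r))
          = Q.map fun r => rt * sgn (v r * w r) := by
        refine List.map_congr_left fun r hr => ?_
        rw [Function.update_of_ne (fun h : r = q => hQ.1 (h ▸ hr))]
      rw [hmap]
      have hc : (∀ r ∉ Q, v r = Function.update w q (v q) r) ↔ ∀ r ∉ q :: Q, v r = w r := by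
        constructor
        · intro h r hr
          rw [List.mem_cons, not_or] at hr
          rw [h r hr.2, Function.update_of_ne hr.1]
        · intro h r hr
          by_cases hq : r = q
          · subst hq; simp
          · rw [Function.update_of_ne hq]
            exact h r (by simp [hq, hr])
      simp only [hc, List.map_cons, List.prod_cons, mul_ite, mul_zero]
    · intro c _ hc
      rw [LCirc.run_smul, Pi.smul_apply, ih hQ.2, if_neg, smul_zero]
      intro h
      have := h q hQ.1
      simp at this
      exact hc this.symm
    · simp

lemma run_layer_had [Fintype ι] (S : Finset ι) (w v : ι → ZMod 2) :
    LCirc.run (layer had S) (bket w) v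
      = if ∀ q ∉ S, v q = w q then rt ^ S.card * sgn (∑ q ∈ S, v q * w q) else 0 := by
  rw [layer, run_had_list _ S.nodup_toList, Finset.prod_map_toList, Finset.prod_mul_distrib,
    Finset.prod_const, sgn_sum]
  simp

lemma touched_layer_had (S : Finset ι) : LCirc.touched (layer had S) = S := by
  have : ∀ L : List ι, LCirc.touched (L.map had) = L.toFinset := by
    intro L
    induction L with
    | nil => rfl
    | cons q L ih => 
      rw [List.map_cons, LCirc.touched_cons, ih, List.toFinset_cons, Finset.insert_eq]; rfl
  rw [layer, this, Finset.toList_toFinset]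

end Layers

/-! ### Averaging over the number of iterations -/

/-- Sequences s_k = sin(kγ) and c_k = cos(kψ) satisfy s_(k+1) + s_(k-1) = 2 cos γ s_k and the
analogue with ψ. Hence the k-th term on the left is an increment of the discrete Wronskian s_k
c_(k+1) - s_(k+1) c_k, and the sum telescopes. -/
lemma two_mul_cos_sub_cos_mul_sum (γ ψ : ℝ) (N : ℕ) :
    2 * (Real.cos ψ - Real.cos γ) *
        ∑ k ∈ Finset.range N, Real.sin ((k + 1 : ℝ) * γ) * Real.cos ((k + 1 : ℝ) * ψ)
      = Real.sin (N * γ) * Real.cos ((N + 1) * ψ) - Real.sin ((N + 1) * γ) * Real.cos (N * ψ)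
        + Real.sin γ := by
  induction N with
  | zero => simp
  | succ N ih =>
    rw [Finset.sum_range_succ, mul_add, ih]
    push_cast
    have e1 : ((N : ℝ) + 1 + 1) * ψ = (N + 1) * ψ + ψ := by ring
    have e2 : (N : ℝ) * ψ = (N + 1) * ψ - ψ := by ring
    have e3 : ((N : ℝ) + 1 + 1) * γ = (N + 1) * γ + γ := by ring
    have e4 : (N : ℝ) * γ = (N + 1) * γ - γ := by ring
    rw [e1, e2, e3, e4, Real.cos_add, Real.cos_sub, Real.sin_add, Real.sin_sub]
    ring

/-- The choice γ = π/(N+1) makes sin((N+1)γ) vanish and sin(Nγ) = sin γ, so the closed form becomes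
sin γ (1 + cos((N+1)ψ)) ≥ 0, while the factor cos ψ - cos γ is negative for γ < ψ ≤ π. -/
lemma sum_sin_mul_cos_nonpos {N : ℕ} {ψ : ℝ} (h1 : Real.pi / (N + 1) < ψ) (h2 : ψ ≤ Real.pi) :
    ∑ k ∈ Finset.range N, Real.sin ((k + 1 : ℝ) * (Real.pi / (N + 1))) *
      Real.cos ((k + 1 : ℝ) * ψ) ≤ 0 := by
  set γ := Real.pi / (N + 1) with hγ
  have hN : (0 : ℝ) < N + 1 := by positivity
  have hγ0 : 0 < γ := by positivity
  have e : ((N : ℝ) + 1) * γ = Real.pi := by rw [hγ]; field_simp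
  have e' : (N : ℝ) * γ = Real.pi - γ := by rw [← e]; ring
  have key := two_mul_cos_sub_cos_mul_sum γ ψ N
  rw [e, e', Real.sin_pi, Real.sin_pi_sub] at key
  have hlt : Real.cos ψ < Real.cos γ := Real.cos_lt_cos_of_nonneg_of_le_pi hγ0.le h2 h1
  have hs : 0 ≤ Real.sin γ := Real.sin_nonneg_of_nonneg_of_le_pi hγ0.le (h1.le.trans h2)
  have hc : -1 ≤ Real.cos ((N + 1) * ψ) := Real.neg_one_le_cos _
  by_contra hcon
  push Not at hcon
  nlinarith [mul_nonneg hs (by linarith : 0 ≤ Real.cos ((N + 1) * ψ) + 1),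
    mul_pos (sub_pos.mpr hlt) hcon]

/-- Success probabilities of consecutive iteration counts add up to 1 - cos(2θ) cos(4(k+1)θ). The
weighted mean of the second cosine is nonpositive by `sum_sin_mul_cos_nonpos` with ψ = 4θ, and
cos(2θ) ≥ 0 as θ ≤ π/4. -/
lemma sum_sin_le_sum_sin_mul {N : ℕ} {θ : ℝ} (h1 : Real.pi / (N + 1) < 4 * θ)
    (h2 : θ ≤ Real.pi / 4) :
    ∑ k ∈ Finset.range N, Real.sin ((k + 1 : ℝ) * (Real.pi / (N + 1))) ≤
      ∑ k ∈ Finset.range N, Real.sin ((k + 1 : ℝ) * (Real.pi / (N + 1))) *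
        (Real.sin ((2 * ((k + 1 : ℕ) : ℝ) + 1) * θ) ^ 2
          + Real.sin ((2 * (k : ℝ) + 1) * θ) ^ 2) := by
  have h3 := sum_sin_mul_cos_nonpos h1 (by linarith)
  have h0 : 0 < θ := by
    have : 0 < Real.pi / ((N : ℝ) + 1) := by positivity
    linarith
  have hc : 0 ≤ Real.cos (2 * θ) :=
    Real.cos_nonneg_of_mem_Icc ⟨by linarith [Real.pi_pos], by linarith⟩
  have e : ∀ k : ℕ, Real.sin ((2 * ((k + 1 : ℕ) : ℝ) + 1) * θ) ^ 2
      + Real.sin ((2 * (k : ℝ) + 1) * θ) ^ 2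
      = 1 - Real.cos (2 * θ) * Real.cos ((k + 1 : ℝ) * (4 * θ)) := by
    intro k
    rw [Real.sin_sq_eq_half_sub, Real.sin_sq_eq_half_sub]
    push_cast
    have a1 : 2 * ((2 * ((k : ℝ) + 1) + 1) * θ) = (k + 1) * (4 * θ) + 2 * θ := by ring
    have a2 : 2 * ((2 * (k : ℝ) + 1) * θ) = (k + 1) * (4 * θ) - 2 * θ := by ring
    rw [a1, a2, Real.cos_add, Real.cos_sub]
    ring
  have e' : ∑ k ∈ Finset.range N, Real.sin ((k + 1 : ℝ) * (Real.pi / (N + 1))) *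
        (Real.sin ((2 * ((k + 1 : ℕ) : ℝ) + 1) * θ) ^ 2
          + Real.sin ((2 * (k : ℝ) + 1) * θ) ^ 2)
      = ∑ k ∈ Finset.range N, Real.sin ((k + 1 : ℝ) * (Real.pi / (N + 1)))
        - Real.cos (2 * θ) * ∑ k ∈ Finset.range N, Real.sin ((k + 1 : ℝ) * (Real.pi / (N + 1))) *
            Real.cos ((k + 1 : ℝ) * (4 * θ)) := by
    rw [Finset.mul_sum, ← Finset.sum_sub_distrib]
    refine Finset.sum_congr rfl fun k _ => ?_
    rw [e k]; ring
  rw [e']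
  nlinarith [mul_nonneg hc (neg_nonneg.mpr h3)]

/-- The weights do not depend on y, so the inequality for a single angle can be summed over `S`. A
positive combination of the pair sums `P (k + 1) + P k` is then at least the card of `S` times the
total weight, which excludes that every `P j` lies below half the card. -/
lemma exists_iterations {Y : Type} (S : Finset Y) (θ : Y → ℝ) {N : ℕ} (hN : 1 ≤ N)
    (h1 : ∀ y ∈ S, Real.pi / (N + 1) < 4 * θ y) (h2 : ∀ y ∈ S, θ y ≤ Real.pi / 4) :
    ∃ j ≤ N, (S.card : ℝ) / 2 ≤ ∑ y ∈ S, Real.sin ((2 * (j : ℝ) + 1) * θ y) ^ 2 := by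
  by_contra hcon
  push Not at hcon
  set s : ℕ → ℝ := fun k => Real.sin ((k + 1 : ℝ) * (Real.pi / (N + 1))) with hs
  have spos : ∀ k ∈ Finset.range N, 0 < s k := by
    intro k hk
    have hk' : ((k : ℝ) + 1) < N + 1 := by exact_mod_cast Nat.succ_lt_succ (Finset.mem_range.mp hk)
    refine Real.sin_pos_of_pos_of_lt_pi (by positivity) ?_
    rw [← mul_div_assoc, div_lt_iff₀ (by positivity), mul_comm Real.pi]
    exact mul_lt_mul_of_pos_right hk' Real.pi_pos
  set P : ℕ → ℝ := fun j => ∑ y ∈ S, Real.sin ((2 * (j : ℝ) + 1) * θ y) ^ 2 with hP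
  have lower : (S.card : ℝ) * ∑ k ∈ Finset.range N, s k ≤
      ∑ k ∈ Finset.range N, s k * (P (k + 1) + P k) := by
    have := Finset.sum_le_sum fun y hy => sum_sin_le_sum_sin_mul (h1 y hy) (h2 y hy)
    rw [Finset.sum_const, nsmul_eq_mul] at this
    refine this.trans_eq ?_
    rw [Finset.sum_comm]
    refine Finset.sum_congr rfl fun k _ => ?_
    rw [← Finset.mul_sum, Finset.sum_add_distrib]
  have upper : ∑ k ∈ Finset.range N, s k * (P (k + 1) + P k) <
      ∑ k ∈ Finset.range N, s k * (S.card : ℝ) := by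
    refine Finset.sum_lt_sum_of_nonempty ⟨0, Finset.mem_range.mpr hN⟩ fun k hk => ?_
    have hk' := Finset.mem_range.mp hk
    have a := hcon (k + 1) hk'
    have b := hcon k hk'.le
    exact mul_lt_mul_of_pos_left (by simp only [hP]; linarith) (spos k hk)
  rw [← Finset.sum_mul, mul_comm] at upper
  linarith

/-! ### Amplitude amplification -/

section Amplification

variable {ι : Type} [DecidableEq ι]

/-- One iteration of amplitude amplification. -/
noncomputable def groverStep (U M R : LCirc ι) : LCirc ι := M ++ LCirc.inv U ++ R ++ U

/-- Amplitude amplification with `j` iterations. -/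
noncomputable def grover (U M R : LCirc ι) : ℕ → LCirc ι
  | 0 => U
  | j + 1 => grover U M R j ++ groverStep U M R

lemma length_grover (U M R : LCirc ι) (j : ℕ) :
    (grover U M R j).length = U.length + j * (M.length + 2 * U.length + R.length) := by
  induction j with
  | zero => simp [grover]
  | succ j ih => simp [grover, groverStep, ih]; ring

/-- The part of a state on the strings with property `P`. -/
noncomputable def restr (P : (ι → ZMod 2) → Prop) [DecidablePred P] (ψ : Amp ι) : Amp ι :=
  fun w => if P w then ψ w else 0

/-- The data of amplitude amplification: `U` prepares the start state from `w₀`, and `M` and `R` are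
sign changes of the marked strings and of `w₀`, correct on states that agree with `w₀` on `A`. -/
structure AmpSetup (U M R : LCirc ι) (w₀ : ι → ZMod 2) (A : Set ι)
    (P : (ι → ZMod 2) → Prop) [DecidablePred P] [Fintype ι] : Prop where
  keep : U.Keeps A
  keep_inv : U.inv.Keeps A
  mark : ∀ ψ : Amp ι, (∀ w, ψ w ≠ 0 → ∀ q ∈ A, w q = w₀ q) →
    ∀ w, M.run ψ w = (if P w then -1 else 1) * ψ w
  refl : ∀ ψ : Amp ι, (∀ w, ψ w ≠ 0 → ∀ q ∈ A, w q = w₀ q) →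
    ∀ w, R.run ψ w = (if w = w₀ then -1 else 1) * ψ w

namespace AmpSetup

variable [Fintype ι] {U M R : LCirc ι} {w₀ : ι → ZMod 2} {A : Set ι}
  {P : (ι → ZMod 2) → Prop} [DecidablePred P]

lemma supp_start (h : AmpSetup U M R w₀ A P) :
    ∀ w, U.run (bket w₀) w ≠ 0 → ∀ q ∈ A, w q = w₀ q := by
  intro w hw q hq
  obtain ⟨w', h1, h2⟩ := h.keep _ _ hw
  have : w' = w₀ := by
    by_contra hne
    simp [bket, hne] at h1
  rw [← h2 q hq, this]

/-- Conjugating the reflection about `w₀` by `U` gives the reflection about the start state. The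
circuit `R` is only controlled on states that agree with `w₀` on `A`; `keep_inv` ensures that the
state still does after undoing `U`. -/
lemma run_reflection (h : AmpSetup U M R w₀ A P) (ψ : Amp ι)
    (hψ : ∀ w, ψ w ≠ 0 → ∀ q ∈ A, w q = w₀ q) :
    LCirc.run (LCirc.inv U ++ R ++ U) ψ
      = ψ - (2 * ip (U.run (bket w₀)) ψ) • U.run (bket w₀) := by
  have h1 : ∀ w, U.inv.run ψ w ≠ 0 → ∀ q ∈ A, w q = w₀ q := by
    intro w hw q hq
    obtain ⟨w', h1, h2⟩ := h.keep_inv _ _ hw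
    rw [← h2 q hq, hψ w' h1 q hq]
  have h2 : R.run (U.inv.run ψ) = U.inv.run ψ - (2 * U.inv.run ψ w₀) • bket w₀ := by
    funext w
    rw [h.refl _ h1]
    by_cases hw : w = w₀
    · subst hw; simp [bket]; ring
    · simp [bket, hw]
  rw [LCirc.run_append, LCirc.run_append, h2, LCirc.run_sub, LCirc.run_smul, LCirc.run_run_inv,
    LCirc.ip_run_left, ip_bket_left]

/-- The marked part and the unmarked part of the start state span an invariant plane, on which one
iteration is minus the rotation by 2θ. The two parts are not normalised; their norms are sin θ and
cos θ, whence the denominators. -/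
lemma run_grover (h : AmpSetup U M R w₀ A P) {θ : ℝ} (h0 : 0 < θ) (h1 : θ ≤ Real.pi / 4)
    (hθ : ∑ w, (if P w then ‖U.run (bket w₀) w‖ ^ 2 else 0) = Real.sin θ ^ 2) (j : ℕ) :
    (grover U M R j).run (bket w₀) = ((-1 : ℂ) ^ j) •
      (((Real.sin ((2 * (j : ℝ) + 1) * θ) / Real.sin θ : ℝ) : ℂ) • restr P (U.run (bket w₀))
        + ((Real.cos ((2 * (j : ℝ) + 1) * θ) / Real.cos θ : ℝ) : ℂ) •
          restr (fun w => ¬ P w) (U.run (bket w₀))) := by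
  have hpi := Real.pi_pos
  have hs : Real.sin θ ≠ 0 := (Real.sin_pos_of_pos_of_lt_pi h0 (by linarith)).ne'
  have hc : Real.cos θ ≠ 0 := (Real.cos_pos_of_mem_Ioo ⟨by linarith, by linarith⟩).ne'
  set s := U.run (bket w₀) with hsdef
  set g := restr P s with hg
  set b := restr (fun w => ¬ P w) s with hb
  have hgb : s = g + b := by
    funext w
    by_cases hw : P w <;> simp [hg, hb, restr, hw]
  induction j with
  | zero => simp [grover, div_self hs, div_self hc, ← hsdef, ← hgb]
  | succ j ih =>
    have supp := h.supp_start
    have suppg : ∀ w, g w ≠ 0 → ∀ q ∈ A, w q = w₀ q := by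
      intro w hw
      refine supp w fun h' => hw ?_
      simp [hg, restr, hsdef, h']
    have suppb : ∀ w, b w ≠ 0 → ∀ q ∈ A, w q = w₀ q := by
      intro w hw
      refine supp w fun h' => hw ?_
      simp [hb, restr, hsdef, h']
    have hMg : M.run g = -g := by
      funext w
      rw [h.mark g suppg]
      by_cases hw : P w <;> simp [hg, restr, hw]
    have hMb : M.run b = b := by
      funext w
      rw [h.mark b suppb]
      by_cases hw : P w <;> simp [hb, restr, hw]
    have ipg : ip s g = ((Real.sin θ ^ 2 : ℝ) : ℂ) := by
      rw [← hθ, ip, Complex.ofReal_sum]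
      refine Finset.sum_congr rfl fun w _ => ?_
      by_cases hw : P w
      · simpa [hg, restr, hw] using Complex.conj_mul' (s w)
      · simp [hg, restr, hw]
    have ips : ip s s = 1 := by
      rw [hsdef, LCirc.ip_run_run, ip_self, sum_norm_bket]; simp
    have ipb : ip s b = ((Real.cos θ ^ 2 : ℝ) : ℂ) := by
      have : ip s s = ip s g + ip s b := by
        conv_lhs => rw [ip]; rw [hgb]
        simp only [ip, Pi.add_apply, mul_add, Finset.sum_add_distrib]
        rw [← Finset.sum_add_distrib, ← Finset.sum_add_distrib]
        refine Finset.sum_congr rfl fun w _ => ?_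
        rw [hgb]; simp
      rw [ips, ipg] at this
      rw [Real.cos_sq']
      push_cast at this ⊢
      linear_combination -this
    have stepg : (groverStep U M R).run g = (-(1 - 2 * (Real.sin θ : ℂ) ^ 2)) • g
        + (2 * (Real.sin θ : ℂ) ^ 2) • b := by
      rw [groverStep, List.append_assoc, List.append_assoc, LCirc.run_append, hMg, LCirc.run_neg,
        ← List.append_assoc, h.run_reflection g suppg, ← hsdef, ipg, hgb]
      push_cast
      module
    have stepb : (groverStep U M R).run b = (-(2 * (Real.cos θ : ℂ) ^ 2)) • g
        + (1 - 2 * (Real.cos θ : ℂ) ^ 2) • b := by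
      rw [groverStep, List.append_assoc, List.append_assoc, LCirc.run_append, hMb,
        ← List.append_assoc, h.run_reflection b suppb, ← hsdef, ipb, hgb]
      push_cast
      module
    rw [grover, LCirc.run_append, ih, LCirc.run_smul, LCirc.run_add, LCirc.run_smul,
      LCirc.run_smul, stepg, stepb]
    have ex : Real.sin ((2 * ((j + 1 : ℕ) : ℝ) + 1) * θ) / Real.sin θ
        = (1 - 2 * Real.sin θ ^ 2) * (Real.sin ((2 * (j : ℝ) + 1) * θ) / Real.sin θ)
          + 2 * Real.cos θ ^ 2 * (Real.cos ((2 * (j : ℝ) + 1) * θ) / Real.cos θ) := by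
      have : (2 * ((j + 1 : ℕ) : ℝ) + 1) * θ = (2 * (j : ℝ) + 1) * θ + 2 * θ := by
        push_cast; ring
      rw [this, Real.sin_add, Real.cos_two_mul, Real.sin_two_mul, Real.cos_sq']
      field_simp
      linear_combination 2 * Real.sin θ * Real.cos ((2 * (j : ℝ) + 1) * θ) *
        Real.sin_sq_add_cos_sq θ
    have ey : Real.cos ((2 * ((j + 1 : ℕ) : ℝ) + 1) * θ) / Real.cos θ
        = -(2 * Real.sin θ ^ 2) * (Real.sin ((2 * (j : ℝ) + 1) * θ) / Real.sin θ)
          + (2 * Real.cos θ ^ 2 - 1) * (Real.cos ((2 * (j : ℝ) + 1) * θ) / Real.cos θ) := by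
      have : (2 * ((j + 1 : ℕ) : ℝ) + 1) * θ = (2 * (j : ℝ) + 1) * θ + 2 * θ := by
        push_cast; ring
      rw [this, Real.cos_add, Real.cos_two_mul, Real.sin_two_mul]
      field_simp
      ring
    rw [ex, ey, pow_succ]
    push_cast
    module

/-- The weight of the marked strings after `j` iterations. -/
lemma weight_grover (h : AmpSetup U M R w₀ A P) {θ : ℝ} (h0 : 0 < θ) (h1 : θ ≤ Real.pi / 4)
    (hθ : ∑ w, (if P w then ‖U.run (bket w₀) w‖ ^ 2 else 0) = Real.sin θ ^ 2) (j : ℕ) :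
    ∑ w, (if P w then ‖(grover U M R j).run (bket w₀) w‖ ^ 2 else 0)
      = Real.sin ((2 * (j : ℝ) + 1) * θ) ^ 2 := by
  have hpi := Real.pi_pos
  have hs : Real.sin θ ≠ 0 := (Real.sin_pos_of_pos_of_lt_pi h0 (by linarith)).ne'
  have e : ∀ w, (if P w then ‖(grover U M R j).run (bket w₀) w‖ ^ 2 else 0)
      = (Real.sin ((2 * (j : ℝ) + 1) * θ) / Real.sin θ) ^ 2 *
        (if P w then ‖U.run (bket w₀) w‖ ^ 2 else 0) := by
    intro w
    by_cases hw : P w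
    · rw [h.run_grover h0 h1 hθ j]
      simp only [hw, if_true, restr, Pi.smul_apply, Pi.add_apply, not_true, if_false, smul_eq_mul,
        mul_zero, add_zero, norm_mul, norm_pow, norm_neg, norm_one, one_pow, one_mul,
        Complex.norm_real, mul_pow, Real.norm_eq_abs, sq_abs]
    · simp [hw]
  rw [Finset.sum_congr rfl fun w _ => e w, ← Finset.mul_sum, hθ]
  field_simp

/-- All strings in the final state agree with `w₀` on `A`. -/
lemma supp_grover (h : AmpSetup U M R w₀ A P) {θ : ℝ} (h0 : 0 < θ) (h1 : θ ≤ Real.pi / 4)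
    (hθ : ∑ w, (if P w then ‖U.run (bket w₀) w‖ ^ 2 else 0) = Real.sin θ ^ 2) (j : ℕ)
    (w : ι → ZMod 2) (hw : (grover U M R j).run (bket w₀) w ≠ 0) : ∀ q ∈ A, w q = w₀ q := by
  refine h.supp_start w fun h' => hw ?_
  rw [h.run_grover h0 h1 hθ j]
  simp [restr, h']

end AmpSetup

end Amplification

/-! ### The inverter -/

/-- The qubits of the inverter besides its input: the candidate preimage `x`, the qubits `g` of the
predictor, a qubit `s` that scales the amplitude, the auxiliary qubits `fa` of the circuit for `f`,
and the auxiliary qubits `ax`, `ag` for multiply controlled signs. -/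
inductive Reg (n m k : ℕ) : Type
  | x (i : Fin n) | g (j : Fin m) | s | fa (j : Fin k) | ax (i : Fin n) | ag (j : Fin m)
  deriving DecidableEq, Fintype

/-- The qubits of the inverter. -/
abbrev Wire (n m k : ℕ) : Type := Fin n ⊕ Reg n m k

section Construction

variable {n m k : ℕ}

/-- The qubits of the candidate preimage. -/
def xw (i : Fin n) : Wire n m k := Sum.inr (.x i)

lemma xw_injective : Function.Injective (xw : Fin n → Wire n m k) := by
  intro i j h; simpa [xw] using h

lemma inl_ne_xw (i j : Fin n) : (Sum.inl i : Wire n m k) ≠ xw j := by simp [xw]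

/-- The qubits of the predictor. -/
def gw : Fin m ↪ Wire n m k := ⟨fun j => Sum.inr (.g j), fun i j h => by simpa using h⟩

lemma gw_apply (j : Fin m) : (gw j : Wire n m k) = Sum.inr (.g j) := rfl

/-- The qubits of the circuit for `f`. -/
def fw : Fin k ↪ Wire n m k :=
  ⟨fun j => if h : (j : ℕ) < n then Sum.inr (.x ⟨j, h⟩) else Sum.inr (.fa j), by
    intro i j h
    simp only at h
    split_ifs at h with h1 h2 h2
    · simpa [Fin.ext_iff] using h
    · simp at h
    · simp at h
    · simpa using h⟩

lemma fw_apply (j : Fin k) : (fw j : Wire n m k)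
    = if h : (j : ℕ) < n then Sum.inr (.x ⟨j, h⟩) else Sum.inr (.fa j) := rfl

/-- The scaling qubit. -/
def sw : Wire n m k := Sum.inr .s

/-- The auxiliary qubits for multiply controlled signs. -/
def anc : Wire n m k → Wire n m k
  | Sum.inr (.x i) => Sum.inr (.ax i)
  | Sum.inr (.g j) => Sum.inr (.ag j)
  | q => q

lemma ancFor_sw {S : Finset (Wire n m k)} (h : ∀ q ∈ S, (∃ i, q = xw i) ∨ ∃ j, q = gw j) :
    AncFor anc sw S where
  notMem hs := by rcases h _ hs with ⟨i, hi⟩ | ⟨j, hj⟩ <;> simp_all [xw, gw_apply, sw]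
  ne q hq := by
    rcases h q hq with ⟨i, rfl⟩ | ⟨j, rfl⟩ <;> simp [xw, gw_apply, sw, anc]
  ne' q hq q' hq' := by
    rcases h q hq with ⟨i, rfl⟩ | ⟨j, rfl⟩ <;> rcases h q' hq' with ⟨i', rfl⟩ | ⟨j', rfl⟩ <;>
      simp [xw, gw_apply, anc]
  inj q hq q' hq' := by
    rcases h q hq with ⟨i, rfl⟩ | ⟨j, rfl⟩ <;> rcases h q' hq' with ⟨i', rfl⟩ | ⟨j', rfl⟩ <;>
      simp [xw, gw_apply, anc]

/-- The position of the `i`-th bit of the first string in the predictor's input. -/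
def yIdx (hm : n + n ≤ m) (i : Fin n) : Fin m := Fin.castLE hm (Fin.castAdd n i)

/-- The position of the `i`-th bit of the second string in the predictor's input. -/
def xIdx (hm : n + n ≤ m) (i : Fin n) : Fin m := Fin.castLE hm (Fin.natAdd n i)

/-- The sources of the bits that are copied to the predictor. -/
def copySrc : Fin n ⊕ Fin n → Wire n m k
  | Sum.inl i => Sum.inl i
  | Sum.inr i => xw i

/-- The targets of the bits that are copied to the predictor. -/
def copyTgt (hm : n + n ≤ m) : Fin n ⊕ Fin n → Wire n m k
  | Sum.inl i => gw (yIdx hm i)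
  | Sum.inr i => gw (xIdx hm i)

lemma copySrc_ne_copyTgt (hm : n + n ≤ m) (i j : Fin n ⊕ Fin n) :
    (copySrc i : Wire n m k) ≠ copyTgt hm j := by
  cases i <;> cases j <;> simp [copySrc, copyTgt, xw, gw_apply]

lemma copyTgt_injective (hm : n + n ≤ m) :
    Function.Injective (copyTgt hm : Fin n ⊕ Fin n → Wire n m k) := by
  rintro (i | i) (j | j) h <;>
    simp only [copyTgt, gw.injective.eq_iff, yIdx, xIdx, Fin.ext_iff, Fin.val_castLE,
      Fin.val_castAdd, Fin.val_natAdd] at h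
  · rw [Fin.ext h]
  · omega
  · omega
  · rw [show i = j from Fin.ext (by omega)]

/-- Copying the bits in `B` of both strings to the predictor. -/
noncomputable def copyC (hm : n + n ≤ m) (B : Finset (Fin n)) : LCirc (Wire n m k) :=
  layer (fun i => cx 0 (copySrc i) (copyTgt hm i) (copySrc_ne_copyTgt hm i i)) (B.disjSum B)

lemma xorFamily_copy (hm : n + n ≤ m) :
    XorFamily (fun i => cx 0 (copySrc i) (copyTgt hm i) (copySrc_ne_copyTgt hm i i))
      (copyTgt hm : Fin n ⊕ Fin n → Wire n m k) (fun i w => w (copySrc i) + 0) :=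
  xorFamily_cx 0 copySrc (copyTgt hm) (copySrc_ne_copyTgt hm) (copyTgt_injective hm)

/-- A uniform superposition over the candidates supported on `B`, on which the predictor is run. -/
noncomputable def prep (hm : n + n ≤ m) (B : Finset (Fin n)) (G : LCirc (Fin m)) :
    LCirc (Wire n m k) :=
  layer had (B.image xw) ++ copyC hm B ++ LCirc.emb gw G

/-- The prediction, as a sign. -/
noncomputable def signC (hm : n + n ≤ m) (hm₁ : 1 ≤ m) (B : Finset (Fin n)) (G : LCirc (Fin m)) :
    LCirc (Wire n m k) :=
  prep hm B G ++ [zG (gw ⟨0, hm₁⟩)] ++ LCirc.inv (prep hm B G)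

/-- The preparation of the start state of amplitude amplification. -/
noncomputable def startC (hm : n + n ≤ m) (hm₁ : 1 ≤ m) (B : Finset (Fin n)) (G : LCirc (Fin m)) :
    LCirc (Wire n m k) :=
  signC hm hm₁ B G ++ [had sw]

/-- The sign change of the correct candidates. -/
noncomputable def markC (B : Finset (Fin n)) (F : LCirc (Fin k)) : LCirc (Wire n m k) :=
  LCirc.emb fw F ++
    eqSign anc sw (Sum.inl : Fin n → Wire n m k) xw inl_ne_xw B ++
    LCirc.inv (LCirc.emb fw F)

/-- The qubits that `signC` may change. -/
def active (hm : n + n ≤ m) (hm₁ : 1 ≤ m) (B : Finset (Fin n)) (G : LCirc (Fin m)) :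
    Finset (Wire n m k) :=
  B.image xw ∪ (insert ⟨0, hm₁⟩ (G.touched ∪ (B.image (yIdx hm) ∪ B.image (xIdx hm)))).image gw

/-- The reflection about the initial state of the active qubits and the scaling qubit. -/
noncomputable def reflC (hm : n + n ≤ m) (hm₁ : 1 ≤ m) (B : Finset (Fin n)) (G : LCirc (Fin m)) :
    LCirc (Wire n m k) :=
  zeroRefl anc sw (active hm hm₁ B G)

/-- The exchange of the input and the candidate on the bits in `B`, for an input equal to the
candidate's image. -/
noncomputable def outC (B : Finset (Fin n)) : LCirc (Wire n m k) :=
  layer (fun i => cx 0 (Sum.inl i : Wire n m k) (xw i) (by simp [xw])) B ++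
    layer (fun i => cx 0 (xw i : Wire n m k) (Sum.inl i) (by simp [xw])) B

/-- The inverter with `j` iterations of amplitude amplification. -/
noncomputable def invC (hm : n + n ≤ m) (hm₁ : 1 ≤ m) (B : Finset (Fin n)) (G : LCirc (Fin m))
    (F : LCirc (Fin k)) (j : ℕ) : LCirc (Wire n m k) :=
  grover (startC hm hm₁ B G) (markC B F) (reflC hm hm₁ B G) j ++ outC B

lemma length_eqSign_le {ι α : Type} [DecidableEq ι] [DecidableEq α] (anc : ι → ι) (c : ι)
    (a t : α → ι) (h : ∀ i j, a i ≠ t j) (S : Finset α) :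
    (eqSign anc c a t h S).length ≤ 16 * S.card + 1 := by
  have h1 := length_ladder_le anc c (S.image t).toList
  have h2 := Finset.card_image_le (s := S) (f := t)
  simp only [Finset.length_toList] at h1
  simp only [eqSign, List.length_append, length_layer, LCirc.length_inv]
  omega

lemma length_zeroRefl_le {ι : Type} [DecidableEq ι] (anc : ι → ι) (c : ι) (S : Finset ι) :
    (zeroRefl anc c S).length ≤ 16 * S.card + 3 := by
  have h1 := length_ladder_le anc c S.toList
  have h2 := Finset.card_insert_le c S
  simp only [Finset.length_toList] at h1
  simp only [zeroRefl, List.length_append, length_layer, LCirc.length_inv]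
  omega

lemma card_active_le (hm : n + n ≤ m) (hm₁ : 1 ≤ m) (B : Finset (Fin n)) (G : LCirc (Fin m)) :
    (active hm hm₁ B G : Finset (Wire n m k)).card ≤ 3 * B.card + 2 * G.length + 1 := by
  unfold active
  have h0 := G.card_touched_le
  have h1 := Finset.card_image_le (s := B) (f := (xw : Fin n → Wire n m k))
  have h2 := Finset.card_image_le (s := B) (f := yIdx hm)
  have h3 := Finset.card_image_le (s := B) (f := xIdx hm)
  refine (Finset.card_union_le _ _).trans ?_
  have h4 := Finset.card_image_le
    (s := insert ⟨0, hm₁⟩ (G.touched ∪ (B.image (yIdx hm) ∪ B.image (xIdx hm))))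
    (f := (gw : Fin m → Wire n m k))
  have h5 := Finset.card_insert_le (⟨0, hm₁⟩ : Fin m)
    (G.touched ∪ (B.image (yIdx hm) ∪ B.image (xIdx hm)))
  have h6 := Finset.card_union_le G.touched (B.image (yIdx hm) ∪ B.image (xIdx hm))
  have h7 := Finset.card_union_le (B.image (yIdx hm)) (B.image (xIdx hm))
  omega

lemma length_invC_le (hm : n + n ≤ m) (hm₁ : 1 ≤ m) (B : Finset (Fin n)) (G : LCirc (Fin m))
    (F : LCirc (Fin k)) (j : ℕ) {σ : ℕ} (hB : B.card ≤ 2 * σ) (hσ : G.length + F.length ≤ σ)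
    (h1 : 1 ≤ σ) : (invC hm hm₁ B G F j).length ≤ 240 * σ * (j + 1) := by
  have hp : (prep hm B G : LCirc (Wire n m k)).length ≤ 3 * B.card + G.length := by
    have := Finset.card_image_le (s := B) (f := (xw : Fin n → Wire n m k))
    simp only [prep, copyC, List.length_append, length_layer, Finset.card_disjSum,
      LCirc.length_emb]
    omega
  have hU : (startC hm hm₁ B G : LCirc (Wire n m k)).length ≤ 2 * (3 * B.card + G.length) + 2 := by
    simp only [startC, signC, List.length_append, LCirc.length_inv, List.length_singleton]
    omega
  have hM : (markC B F : LCirc (Wire n m k)).length ≤ 2 * F.length + 16 * B.card + 1 := by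
    have := length_eqSign_le anc sw (Sum.inl : Fin n → Wire n m k) xw inl_ne_xw B
    simp only [markC, List.length_append, LCirc.length_inv, LCirc.length_emb]
    omega
  have hR : (reflC hm hm₁ B G : LCirc (Wire n m k)).length
      ≤ 16 * (3 * B.card + 2 * G.length + 1) + 3 := by
    have h1 := length_zeroRefl_le anc sw (active hm hm₁ B G : Finset (Wire n m k))
    have h2 := card_active_le (k := k) hm hm₁ B G
    unfold reflC
    omega
  have hO : (outC B : LCirc (Wire n m k)).length = 2 * B.card := by
    simp only [outC, List.length_append, length_layer]; ring
  -- The bounds add up to 76 |B| + 36 |G| + 2 |F| + 24, which is at most 212σ; the additive constant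
  -- is absorbed by σ ≥ 1.
  have hQ : (markC B F : LCirc (Wire n m k)).length +
      2 * (startC hm hm₁ B G : LCirc (Wire n m k)).length +
      (reflC hm hm₁ B G : LCirc (Wire n m k)).length ≤ 240 * σ := by omega
  have hQ' := Nat.mul_le_mul_left j hQ
  rw [invC, List.length_append, length_grover, hO]
  have e : 240 * σ * (j + 1) = j * (240 * σ) + 240 * σ := by ring
  rw [e]
  omega

/-! ### Correctness of the components -/

lemma keeps_signC (hm : n + n ≤ m) (hm₁ : 1 ≤ m) (B : Finset (Fin n)) (G : LCirc (Fin m)) :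
    LCirc.Keeps (signC hm hm₁ B G : LCirc (Wire n m k)) {q | q ∉ active hm hm₁ B G} := by
  have hcopy : ∀ i ∈ B.disjSum B,
      (copyTgt hm i : Wire n m k) ∉ {q : Wire n m k | q ∉ active hm hm₁ B G} := by
    intro i hi h
    refine h (Finset.mem_union_right _ ?_)
    rcases i with i | i
    · have hi : i ∈ B := by simpa using hi
      exact Finset.mem_image_of_mem _ (Finset.mem_insert_of_mem (Finset.mem_union_right _
        (Finset.mem_union_left _ (Finset.mem_image_of_mem _ hi))))
    · have hi : i ∈ B := by simpa using hi
      exact Finset.mem_image_of_mem _ (Finset.mem_insert_of_mem (Finset.mem_union_right _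
        (Finset.mem_union_right _ (Finset.mem_image_of_mem _ hi))))
  have hhad : ∀ q ∈ {q : Wire n m k | q ∉ active hm hm₁ B G}, q ∉ B.image xw :=
    fun q hq h => hq (Finset.mem_union_left _ h)
  have hG : ∀ q ∈ {q : Wire n m k | q ∉ active hm hm₁ B G},
      q ∉ (LCirc.emb gw G).touched := by
    intro q hq h
    rw [LCirc.touched_emb, Finset.mem_map] at h
    obtain ⟨j, hj, rfl⟩ := h
    exact hq (Finset.mem_union_right _ (Finset.mem_image_of_mem _ (by simp [hj])))
  refine ((((LCirc.keeps_of_disjoint _ ?_).append ((xorFamily_copy hm).keeps _ hcopy)).append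
    (LCirc.keeps_of_disjoint _ hG)).append (LCirc.keeps_of_disjoint _ ?_)).append ?_
  · rwa [touched_layer_had]
  · intro q hq h
    simp only [LCirc.touched_cons, LCirc.touched_nil, zG, LGate.touched, Finset.union_empty,
      Finset.mem_singleton] at h
    exact hq (Finset.mem_union_right _ (Finset.mem_image.mpr ⟨⟨0, hm₁⟩, by simp, h.symm⟩))
  · rw [prep, LCirc.inv_append, LCirc.inv_append]
    refine (LCirc.keeps_of_disjoint _ ?_).append
      (((xorFamily_copy hm).keeps_inv _ hcopy).append (LCirc.keeps_of_disjoint _ ?_))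
    · simpa using hG
    · rw [LCirc.touched_inv, touched_layer_had]
      exact hhad

lemma LCirc.Keeps.mono {ι : Type} [DecidableEq ι] {C : LCirc ι} {A A' : Set ι} (h : C.Keeps A)
    (hA : A' ⊆ A) : C.Keeps A' := by
  intro ψ w hw
  obtain ⟨w', h1, h2⟩ := h ψ w hw
  exact ⟨w', h1, fun q hq => h2 q (hA hq)⟩

/-- The qubits that do not change during the amplification. -/
def fixedW (hm : n + n ≤ m) (hm₁ : 1 ≤ m) (B : Finset (Fin n)) (G : LCirc (Fin m)) :
    Set (Wire n m k) := {q | q ∉ insert sw (active hm hm₁ B G)}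

/-- Together with `inv_zG` this shows that `signC` is its own inverse, so that `keeps_signC` also
serves for the inverse of the start circuit. -/
lemma inv_signC (hm : n + n ≤ m) (hm₁ : 1 ≤ m) (B : Finset (Fin n)) (G : LCirc (Fin m)) :
    LCirc.inv (signC hm hm₁ B G : LCirc (Wire n m k))
      = prep hm B G ++ LCirc.inv [zG (gw ⟨0, hm₁⟩)] ++ LCirc.inv (prep hm B G) := by
  rw [signC, LCirc.inv_append, LCirc.inv_append, LCirc.inv_inv, List.append_assoc]

lemma inv_zG {ι : Type} [DecidableEq ι] (q : ι) : LCirc.inv [zG q] = [zG q] := by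
  have : (diagU sgn fun a => by rw [star_sgn, sgn_mul_self] : Matrix.unitaryGroup (ZMod 2) ℂ)⁻¹
      = diagU sgn fun a => by rw [star_sgn, sgn_mul_self] := by
    refine Subtype.ext ?_
    change star (Matrix.diagonal sgn) = Matrix.diagonal sgn
    rw [Matrix.star_eq_conjTranspose, Matrix.diagonal_conjTranspose]
    congr 1
    funext a
    exact star_sgn a
  simp [LCirc.inv, zG, LGate.inv, this]

lemma keeps_startC (hm : n + n ≤ m) (hm₁ : 1 ≤ m) (B : Finset (Fin n)) (G : LCirc (Fin m)) :
    LCirc.Keeps (startC hm hm₁ B G : LCirc (Wire n m k)) (fixedW hm hm₁ B G) := by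
  refine ((keeps_signC hm hm₁ B G).mono ?_).append (LCirc.keeps_of_disjoint _ ?_)
  · intro q hq h; exact hq (Finset.mem_insert_of_mem h)
  · intro q hq h
    simp only [LCirc.touched_cons, LCirc.touched_nil, had, LGate.touched, Finset.union_empty,
      Finset.mem_singleton] at h
    exact hq (by simp [h])

lemma keeps_inv_startC (hm : n + n ≤ m) (hm₁ : 1 ≤ m) (B : Finset (Fin n)) (G : LCirc (Fin m)) :
    LCirc.Keeps (LCirc.inv (startC hm hm₁ B G : LCirc (Wire n m k))) (fixedW hm hm₁ B G) := by
  rw [startC, LCirc.inv_append, inv_signC, inv_zG]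
  refine (LCirc.keeps_of_disjoint _ ?_).append ((keeps_signC hm hm₁ B G).mono ?_)
  · intro q hq h
    rw [LCirc.touched_inv] at h
    simp only [LCirc.touched_cons, LCirc.touched_nil, had, LGate.touched, Finset.union_empty,
      Finset.mem_singleton] at h
    exact hq (by simp [h])
  · intro q hq h; exact hq (Finset.mem_insert_of_mem h)

/-- The initial string of the inverter on input `b`. -/
def initW (b : Bits n) : Wire n m k → ZMod 2
  | Sum.inl i => b i
  | Sum.inr _ => 0

/-- The string holds the candidate `y`, and the scaling qubit is set. -/
def Marked (y : Bits n) (w : Wire n m k → ZMod 2) : Prop := w sw = 1 ∧ ∀ i, w (xw i) = y i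

instance (y : Bits n) : DecidablePred (Marked y : (Wire n m k → ZMod 2) → Prop) :=
  fun _ => inferInstanceAs (Decidable (_ ∧ _))

lemma active_cases {hm : n + n ≤ m} {hm₁ : 1 ≤ m} {B : Finset (Fin n)} {G : LCirc (Fin m)}
    (q : Wire n m k) (hq : q ∈ active hm hm₁ B G) : (∃ i ∈ B, q = xw i) ∨ ∃ j, q = gw j := by
  rcases Finset.mem_union.mp hq with h | h
  · obtain ⟨i, hi, rfl⟩ := Finset.mem_image.mp h
    exact Or.inl ⟨i, hi, rfl⟩
  · obtain ⟨j, _, rfl⟩ := Finset.mem_image.mp h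
    exact Or.inr ⟨j, rfl⟩

lemma mem_fixedW {hm : n + n ≤ m} {hm₁ : 1 ≤ m} {B : Finset (Fin n)} {G : LCirc (Fin m)}
    {q : Wire n m k} (h1 : q ≠ sw) (h2 : ∀ i ∈ B, q ≠ xw i) (h3 : ∀ j, q ≠ gw j) :
    q ∈ fixedW hm hm₁ B G := by
  intro h
  rcases Finset.mem_insert.mp h with h | h
  · exact h1 h
  · rcases active_cases q h with ⟨i, hi, h⟩ | ⟨j, h⟩
    · exact h2 i hi h
    · exact h3 j h

/-- The circuit inspects only the scaling qubit and the active qubits. On all others, including the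
ancillas of the ladder, the support hypothesis already forces the initial values. -/
lemma run_reflC (hm : n + n ≤ m) (hm₁ : 1 ≤ m) (B : Finset (Fin n)) (G : LCirc (Fin m))
    (b : Bits n) (ψ : Amp (Wire n m k))
    (hψ : ∀ w, ψ w ≠ 0 → ∀ q ∈ fixedW hm hm₁ B G, w q = initW b q) (w : Wire n m k → ZMod 2) :
    (reflC hm hm₁ B G).run ψ w = (if w = initW b then -1 else 1) * ψ w := by
  have hA : AncFor anc sw (active hm hm₁ B G : Finset (Wire n m k)) :=
    ancFor_sw fun q hq => (active_cases q hq).imp_left fun ⟨i, _, h⟩ => ⟨i, h⟩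
  rw [reflC, hA.run_zeroRefl]
  · by_cases h0 : ψ w = 0
    · simp [h0]
    · congr 2
      refine propext ⟨fun h => funext fun q => ?_, fun h q hq => ?_⟩
      · by_cases hq : q ∈ insert sw (active hm hm₁ B G)
        · rw [h q hq]
          rcases Finset.mem_insert.mp hq with rfl | hq
          · rfl
          · rcases active_cases q hq with ⟨i, _, rfl⟩ | ⟨j, rfl⟩ <;> rfl
        · exact hψ w h0 q hq
      · rw [h]
        rcases Finset.mem_insert.mp hq with rfl | hq
        · rfl
        · rcases active_cases q hq with ⟨i, _, rfl⟩ | ⟨j, rfl⟩ <;> rfl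
  · intro w hw q hq
    rcases active_cases q hq with ⟨i, hi, rfl⟩ | ⟨j, rfl⟩
    · rw [hψ w hw (anc (xw i)) (mem_fixedW (by simp [anc, xw, sw]) (by simp [anc, xw])
        (by simp [anc, xw, gw_apply]))]
      rfl
    · rw [hψ w hw (anc (gw j)) (mem_fixedW (by simp [anc, gw_apply, sw]) (by simp [anc, gw_apply, xw])
        (by simp [anc, gw_apply]))]
      rfl

/-- After the circuit for `f`, a string holds the image of a candidate of the original state. -/
lemma exists_of_run_emb_fw (hk : n ≤ k) (hm : n + n ≤ m) (hm₁ : 1 ≤ m) (B : Finset (Fin n))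
    (G : LCirc (Fin m)) (F : LCirc (Fin k)) (f : Bits n → Bits n)
    (hF : ∀ x v, F.run (bket (padZero k x)) v ≠ 0 → ∀ i, v (Fin.castLE hk i) = f x i)
    (b : Bits n) (ψ : Amp (Wire n m k))
    (hψ : ∀ w, ψ w ≠ 0 → ∀ q ∈ fixedW hm hm₁ B G, w q = initW b q)
    (w : Wire n m k → ZMod 2) (hw : (LCirc.emb fw F).run ψ w ≠ 0) :
    ∃ v, ψ v ≠ 0 ∧ (∀ i, w (xw i) = f (fun i => v (xw i)) i) ∧ v sw = w sw ∧
      (∀ i, w (Sum.inl i) = b i) ∧ (∀ i, w (anc (xw i)) = 0) := by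
  rw [LCirc.run_emb, LCirc.run_apply_eq_sum] at hw
  obtain ⟨u, -, hu⟩ := Finset.exists_ne_zero_of_sum_ne_zero hw
  have h1 := left_ne_zero_of_mul hu
  have h2 := right_ne_zero_of_mul hu
  have hfw : ∀ (i : Fin n), (fw (Fin.castLE hk i) : Wire n m k) = xw i := by
    intro i; simp [fw_apply, xw]
  have hnot : ∀ q : Wire n m k, (∀ i, q ≠ xw i) → (∀ j, q ≠ Sum.inr (.fa j)) →
      Function.extend fw u w q = w q := by
    intro q hq1 hq2
    refine Function.extend_apply' _ _ _ ?_
    rintro ⟨j, rfl⟩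
    by_cases hj : (j : ℕ) < n
    · exact hq1 ⟨j, hj⟩ (by simp [fw_apply, xw, hj])
    · exact hq2 j (by simp [fw_apply, hj])
  have hx : ∀ i, Function.extend fw u w (xw i) = u (Fin.castLE hk i) := by
    intro i
    rw [← hfw, fw.injective.extend_apply]
  -- The auxiliary qubits of `F` are fixed at zero before `F` is run, so `u` is a legitimate padded
  -- input whose first bits are the candidate.
  have hpad : u = padZero k (fun i => Function.extend fw u w (xw i)) := by
    funext j
    by_cases hj : (j : ℕ) < n
    · simp only [padZero, hj, dif_pos, hx]; rfl
    · simp only [padZero, hj, dif_neg, not_false_iff]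
      have e : (fw j : Wire n m k) = Sum.inr (.fa j) := by simp [fw_apply, hj]
      have := hψ _ h1 (fw j)
        (mem_fixedW (by simp [e, sw]) (by simp [e, xw]) (by simp [e, gw_apply]))
      rw [fw.injective.extend_apply] at this
      rw [this, e]; rfl
  refine ⟨_, h1, fun i => ?_, hnot sw (by simp [sw, xw]) (by simp [sw]), fun i => ?_, fun i => ?_⟩
  · rw [hpad] at h2
    have := hF _ _ h2 i
    simpa [hfw] using this
  · have := hψ _ h1 (Sum.inl i) (mem_fixedW (by simp [sw]) (by simp [xw]) (by simp [gw_apply]))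
    rwa [hnot _ (by simp [xw]) (by simp)] at this
  · have := hψ _ h1 (anc (xw i)) (mem_fixedW (by simp [anc, xw, sw]) (by simp [anc, xw])
      (by simp [anc, xw, gw_apply]))
    rwa [hnot _ (by simp [anc, xw]) (by simp [anc, xw])] at this

/-- `F` may leave garbage, but its output is certain, so after `F` every string in the support
carries the image of an original candidate. The marked and the unmarked part of `ψ` are thus sent
into eigenspaces of the comparison, and undoing `F` leaves only the eigenvalue. -/
lemma run_markC (hk : n ≤ k) (hm : n + n ≤ m) (hm₁ : 1 ≤ m) (B : Finset (Fin n))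
    (G : LCirc (Fin m)) (F : LCirc (Fin k)) (f : Equiv.Perm (Bits n))
    (hF : ∀ x v, F.run (bket (padZero k x)) v ≠ 0 → ∀ i, v (Fin.castLE hk i) = f x i)
    (hfix : ∀ x, ∀ i ∉ B, f x i = x i) (y : Bits n) (hy : ∀ i ∉ B, y i = 0)
    (ψ : Amp (Wire n m k))
    (hψ : ∀ w, ψ w ≠ 0 → ∀ q ∈ fixedW hm hm₁ B G, w q = initW (f y) q)
    (w : Wire n m k → ZMod 2) :
    (markC B F).run ψ w = (if Marked y w then -1 else 1) * ψ w := by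
  set E : LCirc (Wire n m k) :=
    eqSign anc sw (Sum.inl : Fin n → Wire n m k) xw inl_ne_xw B with hE
  have hanc : AncFor anc sw (B.image (xw : Fin n → Wire n m k)) := ancFor_sw fun q hq => by
    obtain ⟨i, _, rfl⟩ := Finset.mem_image.mp hq
    exact Or.inl ⟨i, rfl⟩
  have supp : ∀ (P : (Wire n m k → ZMod 2) → Prop) [DecidablePred P],
      ∀ w, restr P ψ w ≠ 0 → ∀ q ∈ fixedW hm hm₁ B G, w q = initW (f y) q := by
    intro P _ w hw
    refine hψ w fun h' => hw ?_
    simp [restr, h']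
  have main : ∀ (P : (Wire n m k → ZMod 2) → Prop) [DecidablePred P] (c : ℂ),
      (∀ v, P v → (∀ i ∉ B, v (xw i) = 0) → (if Marked y v then -1 else 1) = c) →
      (markC B F).run (restr P ψ) = c • restr P ψ := by
    intro P _ c hc
    have h1 : E.run ((LCirc.emb fw F).run (restr P ψ))
        = c • (LCirc.emb fw F).run (restr P ψ) := by
      funext w
      rw [hE, hanc.run_eqSign inl_ne_xw xw_injective (by simp [xw, sw]) (by simp [xw, anc])]
      · rw [Pi.smul_apply, smul_eq_mul]
        by_cases h0 : (LCirc.emb fw F).run (restr P ψ) w = 0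
        · simp [h0]
        · congr 1
          obtain ⟨v, v1, v2, v3, v4, v5⟩ :=
            exists_of_run_emb_fw hk hm hm₁ B G F f hF (f y) _ (supp P) w h0
          have hP : P v := by
            by_contra hcon
            exact v1 (by simp [restr, hcon])
          have hv0 : ∀ i ∉ B, v (xw i) = 0 := fun i hi =>
            supp P v v1 (xw i) (mem_fixedW (by simp [xw, sw])
              (fun i' hi' h => hi (xw_injective h ▸ hi')) (by simp [xw, gw_apply]))
          rw [← hc v hP hv0]
          congr 1
          refine propext ?_
          rw [Marked, v3]
          refine and_congr Iff.rfl ⟨fun h => ?_, fun h i _ => ?_⟩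
          -- Comparing the bits in `B` suffices: elsewhere `f` fixes the bits, and both candidates
          -- vanish there.
          · have : f (fun i => v (xw i)) = f y := by
              funext i
              by_cases hi : i ∈ B
              · rw [← v2, h i hi, v4]
              · rw [hfix _ i hi, hfix _ i hi, hv0 i hi, hy i hi]
            exact fun i => congrFun (f.injective this) i
          · rw [v2, v4, show (fun i => v (xw i)) = y from funext h]
      · intro w hw i _
        obtain ⟨v, v1, v2, v3, v4, v5⟩ :=
          exists_of_run_emb_fw hk hm hm₁ B G F f hF (f y) _ (supp P) w hw
        exact v5 i
    rw [markC, LCirc.run_append, LCirc.run_append, ← hE, h1, LCirc.run_smul, LCirc.run_inv_run]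
  have hsplit : ψ = restr (Marked y) ψ + restr (fun w => ¬ Marked y w) ψ := by
    funext w
    by_cases hw : Marked y w <;> simp [restr, hw]
  conv_lhs => rw [hsplit]
  rw [LCirc.run_add, main (Marked y) (-1) (fun v hv _ => by simp [hv]),
    main (fun w => ¬ Marked y w) 1 (fun v hv _ => by simp [hv])]
  by_cases hw : Marked y w <;> simp [restr, hw]

lemma ampSetup (hk : n ≤ k) (hm : n + n ≤ m) (hm₁ : 1 ≤ m) (B : Finset (Fin n))
    (G : LCirc (Fin m)) (F : LCirc (Fin k)) (f : Equiv.Perm (Bits n))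
    (hF : ∀ x v, F.run (bket (padZero k x)) v ≠ 0 → ∀ i, v (Fin.castLE hk i) = f x i)
    (hfix : ∀ x, ∀ i ∉ B, f x i = x i) (y : Bits n) (hy : ∀ i ∉ B, y i = 0) :
    AmpSetup (startC hm hm₁ B G : LCirc (Wire n m k)) (markC B F) (reflC hm hm₁ B G)
      (initW (f y)) (fixedW hm hm₁ B G) (Marked y) where
  keep := keeps_startC hm hm₁ B G
  keep_inv := keeps_inv_startC hm hm₁ B G
  mark := run_markC hk hm hm₁ B G F f hF hfix y hy
  refl := run_reflC hm hm₁ B G (f y)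

/-- The probability that the inverter outputs `y` on input `f y`. -/
lemma outWeight_le (B : Finset (Fin n))
    (ψ : Amp (Wire n m k)) (b y : Bits n) (hb : ∀ i ∉ B, b i = y i)
    (hψ : ∀ w, ψ w ≠ 0 → ∀ i, w (Sum.inl i) = b i) :
    ∑ w, (if Marked y w then ‖ψ w‖ ^ 2 else 0)
      ≤ ∑ w, (if ∀ i, w (Sum.inl i) = y i then ‖(outC B).run ψ w‖ ^ 2 else 0) := by
  have f1 := xorFamily_cx 0 (Sum.inl : Fin n → Wire n m k) xw (by simp [xw]) xw_injective
  have f2 := xorFamily_cx 0 (xw : Fin n → Wire n m k) Sum.inl (by simp [xw]) Sum.inl_injective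
  set τ₁ := xorMap (xw : Fin n → Wire n m k) (fun i w => w (Sum.inl i) + 0) B with hτ₁
  set τ₂ := xorMap (Sum.inl : Fin n → Wire n m k) (fun i w => w (xw i) + 0) B with hτ₂
  have hrun : ∀ w, (outC B).run ψ w = ψ (τ₁ (τ₂ w)) := by
    intro w
    rw [outC, LCirc.run_append, f2.run, f1.run]
  have i1 : Function.Involutive τ₁ := f1.xorMap_xorMap B
  have i2 : Function.Involutive τ₂ := f2.xorMap_xorMap B
  have hre : ∑ w, (if ∀ i, w (Sum.inl i) = y i then ‖(outC B).run ψ w‖ ^ 2 else 0)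
      = ∑ w, (if ∀ i, τ₂ (τ₁ w) (Sum.inl i) = y i then ‖ψ w‖ ^ 2 else 0) := by
    refine Fintype.sum_bijective (fun w => τ₁ (τ₂ w)) (i1.bijective.comp i2.bijective) _ _ ?_
    intro w
    rw [hrun, i1, i2]
  rw [hre]
  refine Finset.sum_le_sum fun w _ => ?_
  by_cases hw : Marked y w
  · by_cases h0 : ψ w = 0
    · simp [h0]
    · rw [if_pos hw, if_pos]
      intro i
      have hb' := hψ w h0 i
      by_cases hi : i ∈ B
      · rw [hτ₂, xorMap_target Sum.inl_injective hi, hτ₁, xorMap_target xw_injective hi,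
          xorMap_other (by simp [xw]), hw.2 i]
        -- With a the input bit and c the candidate bit, the first layer puts c + a into the
        -- candidate qubit and the second puts a + (c + a) = c into the input qubit, where the
        -- output is read.
        have : ∀ a c : ZMod 2, a + (c + (a + 0) + 0) = c := by decide
        exact this _ _
      · rw [hτ₂, xorMap_of_notMem Sum.inl_injective hi, hτ₁, xorMap_other (by simp [xw]), hb',
          hb i hi]
  · rw [if_neg hw]; positivity

end Construction

/-! ### The amplitude of the correct candidate -/

section Amplitude

variable {n m k : ℕ}

/-- The strings supported on `B`. -/
def suppSet (B : Finset (Fin n)) : Finset (Bits n) :=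
  Fintype.piFinset fun i => if i ∈ B then Finset.univ else {0}

lemma mem_suppSet {B : Finset (Fin n)} {x : Bits n} : x ∈ suppSet B ↔ ∀ i ∉ B, x i = 0 := by
  simp only [suppSet, Fintype.mem_piFinset]
  refine forall_congr' fun i => ?_
  by_cases hi : i ∈ B <;> simp [hi]

/-- The string with input `b`, candidate `x`, and zeros elsewhere. -/
def candW (b x : Bits n) : Wire n m k → ZMod 2
  | Sum.inl i => b i
  | Sum.inr (.x i) => x i
  | _ => 0

/-- The string with input `b`, candidate `x`, predictor qubits `u`, and zeros elsewhere. -/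
def fullW (b x : Bits n) (u : Bits m) : Wire n m k → ZMod 2
  | Sum.inl i => b i
  | Sum.inr (.x i) => x i
  | Sum.inr (.g j) => u j
  | _ => 0

lemma candW_zero (b : Bits n) : (candW b 0 : Wire n m k → ZMod 2) = initW b := by
  funext q
  rcases q with i | (i | j | _ | j | i | j) <;> rfl

/-- The string agrees with the initial string except for candidates in `B` and the predictor. -/
def Admissible (B : Finset (Fin n)) (b : Bits n) (w : Wire n m k → ZMod 2) : Prop :=
  ∀ q, (∀ i ∈ B, q ≠ xw i) → (∀ j, q ≠ gw j) → w q = initW b q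

lemma Admissible.inl {B : Finset (Fin n)} {b : Bits n} {w : Wire n m k → ZMod 2}
    (h : Admissible B b w) (i : Fin n) : w (Sum.inl i) = b i :=
  h _ (by simp [xw]) (by simp [gw_apply])

lemma Admissible.xw {B : Finset (Fin n)} {b : Bits n} {w : Wire n m k → ZMod 2}
    (h : Admissible B b w) (i : Fin n) (hi : i ∉ B) : w (xw i) = 0 :=
  h (QuantumGL.xw i) (fun _ hi' h => hi (xw_injective h ▸ hi')) (by simp [gw_apply, QuantumGL.xw])

lemma padZero_castLE {l : ℕ} (h : l ≤ m) (z : Bits l) (i : Fin l) :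
    padZero m z (Fin.castLE h i) = z i := by simp [padZero]

lemma padZero_yIdx (hm : n + n ≤ m) (b x : Bits n) (i : Fin n) :
    padZero m (Fin.append b x) (yIdx hm i) = b i := by
  rw [yIdx, padZero_castLE, Fin.append_left]

lemma padZero_xIdx (hm : n + n ≤ m) (b x : Bits n) (i : Fin n) :
    padZero m (Fin.append b x) (xIdx hm i) = x i := by
  rw [xIdx, padZero_castLE, Fin.append_right]

lemma idx_cases (hm : n + n ≤ m) (j : Fin m) :
    (∃ i, j = yIdx hm i) ∨ (∃ i, j = xIdx hm i) ∨ n + n ≤ (j : ℕ) := by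
  by_cases h1 : (j : ℕ) < n
  · exact Or.inl ⟨⟨j, h1⟩, Fin.ext rfl⟩
  · by_cases h2 : (j : ℕ) < n + n
    · refine Or.inr (Or.inl ⟨⟨j - n, by omega⟩, Fin.ext ?_⟩)
      simp only [xIdx, Fin.val_castLE, Fin.val_natAdd]
      omega
    · exact Or.inr (Or.inr (by omega))

lemma extend_gw_of_ne (u : Bits m) (w : Wire n m k → ZMod 2) {q : Wire n m k}
    (hq : ∀ j, q ≠ gw j) : Function.extend gw u w q = w q :=
  Function.extend_apply' _ _ _ (by rintro ⟨j, rfl⟩; exact hq j rfl)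

lemma copyTgt_eq_gw (hm : n + n ≤ m) (i : Fin n ⊕ Fin n) :
    ∃ j, (copyTgt hm i : Wire n m k) = gw j := by
  cases i
  · exact ⟨_, rfl⟩
  · exact ⟨_, rfl⟩

/-- Bits outside `B` are not copied, but both source strings vanish there, so the predictor still
sees its full input. -/
lemma xorMap_copy_gw (hm : n + n ≤ m) {B : Finset (Fin n)} {b : Bits n}
    (hb : ∀ i ∉ B, b i = 0) {w : Wire n m k → ZMod 2} (hw : Admissible B b w) (u : Bits m)
    (j : Fin m) :
    xorMap (copyTgt hm) (fun i w => w (copySrc i) + 0) (B.disjSum B) (Function.extend gw u w) (gw j)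
      = u j + padZero m (Fin.append b fun i => w (xw i)) j := by
  have hu : ∀ j, Function.extend (gw : Fin m → Wire n m k) u w (gw j) = u j :=
    fun j => gw.injective.extend_apply _ _ _
  rcases idx_cases hm j with ⟨i, rfl⟩ | ⟨i, rfl⟩ | hj
  · rw [padZero_yIdx]
    by_cases hi : i ∈ B
    · have : xorMap (copyTgt hm) (fun i w => w (copySrc i) + 0) (B.disjSum B)
          (Function.extend gw u w) (gw (yIdx hm i) : Wire n m k)
          = u (yIdx hm i) + (Function.extend gw u w (Sum.inl i) + 0) :=
        (xorMap_target (copyTgt_injective hm) (i := Sum.inl i) (by simpa using hi) _).trans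
          (congrArg (· + _) (hu _))
      rw [this, extend_gw_of_ne _ _ (by simp [gw_apply]), hw.inl, add_zero]
    · have : xorMap (copyTgt hm) (fun i w => w (copySrc i) + 0) (B.disjSum B)
          (Function.extend gw u w) (gw (yIdx hm i) : Wire n m k) = u (yIdx hm i) :=
        (xorMap_of_notMem (copyTgt_injective hm) (i := Sum.inl i) (by simpa using hi) _).trans
          (hu _)
      rw [this, hb i hi, add_zero]
  · rw [padZero_xIdx]
    by_cases hi : i ∈ B
    · have : xorMap (copyTgt hm) (fun i w => w (copySrc i) + 0) (B.disjSum B)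
          (Function.extend gw u w) (gw (xIdx hm i) : Wire n m k)
          = u (xIdx hm i) + (Function.extend gw u w (xw i) + 0) :=
        (xorMap_target (copyTgt_injective hm) (i := Sum.inr i) (by simpa using hi) _).trans
          (congrArg (· + _) (hu _))
      rw [this, extend_gw_of_ne _ _ (by simp [gw_apply, xw]), add_zero]
    · have : xorMap (copyTgt hm) (fun i w => w (copySrc i) + 0) (B.disjSum B)
          (Function.extend gw u w) (gw (xIdx hm i) : Wire n m k) = u (xIdx hm i) :=
        (xorMap_of_notMem (copyTgt_injective hm) (i := Sum.inr i) (by simpa using hi) _).trans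
          (hu _)
      rw [this, hw.xw i hi, add_zero]
  · rw [xorMap_other, hu]
    · simp [padZero, hj]
    · rintro (i | i) h <;> have := gw.injective h <;>
        simp only [← this, yIdx, xIdx, Fin.val_castLE, Fin.val_castAdd, Fin.val_natAdd] at hj <;>
        omega

-- The amplitudes are computed along slices `extend gw u w` because this is the form in which
-- `run_emb` feeds them to the predictor: each slice is a multiple of one basis state.
open Classical in
lemma run_had_copy (hm : n + n ≤ m) {B : Finset (Fin n)} {b x : Bits n}
    (hb : ∀ i ∉ B, b i = 0) (hx : ∀ i ∉ B, x i = 0) (w : Wire n m k → ZMod 2) (u : Bits m) :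
    LCirc.run (layer had (B.image xw) ++ copyC hm B) (bket (candW b x)) (Function.extend gw u w)
      = (if Admissible B b w then rt ^ B.card * sgn (∑ i ∈ B, w (xw i) * x i) else 0)
        * bket (padZero m (Fin.append b fun i => w (xw i))) u := by
  rw [LCirc.run_append, copyC, (xorFamily_copy hm).run, run_layer_had,
    Finset.card_image_of_injective _ xw_injective, Finset.sum_image xw_injective.injOn]
  set v := xorMap (copyTgt hm) (fun i w => w (copySrc i) + 0) (B.disjSum B)
    (Function.extend (gw : Fin m ↪ Wire n m k) u w) with hv
  have hv1 : ∀ q, (∀ j, q ≠ gw j) → v q = w q := by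
    intro q hq
    rw [hv, xorMap_other, extend_gw_of_ne _ _ hq]
    intro i h
    obtain ⟨j, hj⟩ := copyTgt_eq_gw (k := k) hm i
    exact hq j (h ▸ hj)
  have hcand : ∀ q : Wire n m k, (∀ i ∈ B, q ≠ xw i) → (candW b x : Wire n m k → ZMod 2) q
      = initW b q := by
    intro q hq
    rcases q with i | (i | j | _ | j | i | j)
    · rfl
    · exact hx i fun hi => hq i hi rfl
    all_goals rfl
  have hiff : (∀ q ∉ B.image xw, v q = candW b x q) ↔
      Admissible B b w ∧ u = padZero m (Fin.append b fun i => w (xw i)) := by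
    constructor
    · intro h
      have hA : Admissible B b w := by
        intro q h1 h2
        rw [← hv1 q h2, h q _, hcand q h1]
        intro hq
        obtain ⟨i, hi, rfl⟩ := Finset.mem_image.mp hq
        exact h1 i hi rfl
      refine ⟨hA, funext fun j => ?_⟩
      have h1 := h (gw j) (by simp [xw, gw_apply])
      rw [hv, xorMap_copy_gw hm hb hA] at h1
      have h2 : ∀ a c : ZMod 2, a + c = 0 → a = c := by decide
      exact h2 _ _ h1
    · rintro ⟨hA, hu⟩ q hq
      have hq' : ∀ i ∈ B, q ≠ xw i := fun i hi h => hq (h ▸ Finset.mem_image_of_mem _ hi)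
      by_cases hg : ∃ j, q = gw j
      · obtain ⟨j, rfl⟩ := hg
        rw [hv, xorMap_copy_gw hm hb hA, ← hu, zmod_two_add_self]; rfl
      · push Not at hg
        rw [hv1 q hg, hcand q hq', hA q hq' hg]
  have hsum : ∑ i ∈ B, v (xw i) * candW b x (xw i : Wire n m k)
      = ∑ i ∈ B, w (xw i) * x i :=
    Finset.sum_congr rfl fun i _ => by rw [hv1 _ (by simp [xw, gw_apply])]; rfl
  rw [hsum]
  by_cases hA : Admissible B b w
  · by_cases hu : u = padZero m (Fin.append b fun i => w (xw i))
    · rw [if_pos (hiff.mpr ⟨hA, hu⟩), if_pos hA, bket, if_pos hu, mul_one]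
    · rw [if_neg (fun h => hu (hiff.mp h).2), bket, if_neg hu, mul_zero]
  · rw [if_neg (fun h => hA (hiff.mp h).1), if_neg hA, zero_mul]

open Classical in
lemma run_prep (hm : n + n ≤ m) {B : Finset (Fin n)} (G : LCirc (Fin m)) {b x : Bits n}
    (hb : ∀ i ∉ B, b i = 0) (hx : ∀ i ∉ B, x i = 0) (w : Wire n m k → ZMod 2) :
    (prep hm B G).run (bket (candW b x)) w
      = (if Admissible B b w then rt ^ B.card * sgn (∑ i ∈ B, w (xw i) * x i) else 0)
        * G.run (bket (padZero m (Fin.append b fun i => w (xw i)))) (w ∘ gw) := by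
  rw [prep, LCirc.run_append, LCirc.run_emb]
  have h : (fun u => LCirc.run (layer had (B.image xw) ++ copyC hm B) (bket (candW b x))
        (Function.extend gw u w))
      = (if Admissible B b w then rt ^ B.card * sgn (∑ i ∈ B, w (xw i) * x i) else 0) •
        bket (padZero m (Fin.append b fun i => w (xw i))) :=
    funext fun u => run_had_copy hm hb hx w u
  rw [h, LCirc.run_smul]; rfl

open Classical in
lemma sum_admissible (B : Finset (Fin n)) (b : Bits n) (Φ : Bits n → Bits m → ℂ) :
    ∑ w : Wire n m k → ZMod 2,
        (if Admissible B b w then Φ (fun i => w (xw i)) (w ∘ gw) else 0)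
      = ∑ x ∈ suppSet B, ∑ u, Φ x u := by
  rw [← Finset.sum_filter, ← Finset.sum_product']
  refine Finset.sum_nbij' (fun w => (fun i => w (xw i), w ∘ gw)) (fun p => fullW b p.1 p.2)
    ?_ ?_ ?_ ?_ ?_
  · intro w hw
    rw [Finset.mem_filter] at hw
    simp only [Finset.mem_product, Finset.mem_univ, and_true, mem_suppSet]
    exact fun i hi => hw.2.xw i hi
  · rintro ⟨x, u⟩ hp
    simp only [Finset.mem_product, Finset.mem_univ, and_true, mem_suppSet] at hp
    rw [Finset.mem_filter]
    refine ⟨Finset.mem_univ _, fun q h1 h2 => ?_⟩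
    rcases q with i | (i | j | _ | j | i | j)
    · rfl
    · exact hp i fun hi => h1 i hi rfl
    · exact absurd rfl (h2 j)
    all_goals rfl
  · intro w hw
    rw [Finset.mem_filter] at hw
    funext q
    rcases q with i | (i | j | _ | j | i | j)
    · exact (hw.2.inl i).symm
    · rfl
    · rfl
    · exact (hw.2 (Sum.inr .s) (by simp [xw]) (by simp [gw_apply])).symm
    · exact (hw.2 (Sum.inr (.fa j)) (by simp [xw]) (by simp [gw_apply])).symm
    · exact (hw.2 (Sum.inr (.ax i)) (by simp [xw]) (by simp [gw_apply])).symm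
    · exact (hw.2 (Sum.inr (.ag j)) (by simp [xw]) (by simp [gw_apply])).symm
  · rintro ⟨x, u⟩ _; rfl
  · intro w _; rfl

/-- The expectation of the sign of the predicted bit, on input `z`. -/
noncomputable def signExp (hm₁ : 1 ≤ m) (G : LCirc (Fin m)) (z : Bits m) : ℂ :=
  ∑ u : Bits m, sgn (u ⟨0, hm₁⟩) * (‖G.run (bket z) u‖ ^ 2 : ℝ)

/-- Moving the inverse preparation across the inner product leaves a matrix element of Z between two
prepared states, with candidates y and 0. Both run `G` on the same inputs and differ only by the
Hadamard signs, so the amplitudes of `G`, garbage included, pair up to squared norms. -/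
lemma signC_amplitude (hm : n + n ≤ m) (hm₁ : 1 ≤ m) {B : Finset (Fin n)} (G : LCirc (Fin m))
    {b y : Bits n} (hb : ∀ i ∉ B, b i = 0) (hy : ∀ i ∉ B, y i = 0) :
    (signC hm hm₁ B G : LCirc (Wire n m k)).run (bket (initW b)) (candW b y)
      = (1 / 2) ^ B.card * ∑ x ∈ suppSet B,
          sgn (∑ i ∈ B, x i * y i) * signExp hm₁ G (padZero m (Fin.append b x)) := by
  classical
  rw [signC, LCirc.run_append,
    ← ip_bket_left (candW b y) (LCirc.run (LCirc.inv (prep hm B G)) _), ← LCirc.ip_run_left, LCirc.run_append,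
    ← candW_zero]
  obtain ⟨Φ, hΦ⟩ : ∃ Φ : Bits n → Bits m → ℂ, Φ = fun x u => (1 / 2) ^ B.card *
      (sgn (∑ i ∈ B, x i * y i) *
        (sgn (u ⟨0, hm₁⟩) * (‖G.run (bket (padZero m (Fin.append b x))) u‖ ^ 2 : ℝ))) := ⟨_, rfl⟩
  have e : ∀ w : Wire n m k → ZMod 2,
      star ((prep hm B G).run (bket (candW b y)) w) *
        LCirc.run [zG (gw ⟨0, hm₁⟩)] ((prep hm B G).run (bket (candW b 0))) w
      = if Admissible B b w then Φ (fun i => w (xw i)) (w ∘ gw) else 0 := by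
    intro w
    rw [LCirc.run_cons, LCirc.run_nil, zG_apply, run_prep hm G hb hy,
      run_prep hm G (x := 0) hb (fun _ _ => rfl)]
    by_cases hA : Admissible B b w
    · simp only [hΦ, hA, if_true, Pi.zero_apply, mul_zero, Finset.sum_const_zero, sgn_zero, mul_one,
        star_mul', star_pow, star_rt, star_sgn, Function.comp_apply]
      have h1 : rt ^ B.card * rt ^ B.card = (1 / 2) ^ B.card := by
        rw [← mul_pow, rt_mul_rt]
      rw [← h1, Complex.ofReal_pow, ← Complex.conj_mul']
      simp only [Complex.star_def]
      ring
    · simp [hA]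
  rw [ip, Finset.sum_congr rfl fun w _ => e w, sum_admissible B b Φ, hΦ, Finset.mul_sum]
  refine Finset.sum_congr rfl fun x _ => ?_
  rw [signExp, Finset.mul_sum, Finset.mul_sum]

/-- The scaling qubit is zero before the final Hadamard, which therefore spreads the state evenly
over its two values. -/
lemma run_startC (hm : n + n ≤ m) (hm₁ : 1 ≤ m) (B : Finset (Fin n)) (G : LCirc (Fin m))
    (b : Bits n) (w : Wire n m k → ZMod 2) :
    (startC hm hm₁ B G : LCirc (Wire n m k)).run (bket (initW b)) w
      = rt * (signC hm hm₁ B G).run (bket (initW b)) (Function.update w sw 0) := by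
  have h0 : ∀ w : Wire n m k → ZMod 2, w sw = 1 →
      (signC hm hm₁ B G : LCirc (Wire n m k)).run (bket (initW b)) w = 0 := by
    intro w hw
    by_contra hne
    obtain ⟨w', h1, h2⟩ := keeps_signC hm hm₁ B G _ _ hne
    have h3 : w' = initW b := by
      by_contra hcon
      simp [bket, hcon] at h1
    have h4 := h2 sw (by
      intro hs
      rcases active_cases _ hs with ⟨i, _, h⟩ | ⟨j, h⟩ <;> simp [sw, xw, gw_apply] at h)
    rw [h3, hw] at h4
    exact zero_ne_one h4
  rw [startC, LCirc.run_append, LCirc.run_cons, LCirc.run_nil, had_apply, sum_zmod_two,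
    h0 (Function.update w sw 1) (by simp)]
  simp

/-- The weight of the marked strings in the start state. -/
lemma startC_weight_le (hm : n + n ≤ m) (hm₁ : 1 ≤ m) (B : Finset (Fin n)) (G : LCirc (Fin m))
    (b y : Bits n) :
    ∑ w, (if Marked y w then
      ‖(startC hm hm₁ B G : LCirc (Wire n m k)).run (bket (initW b)) w‖ ^ 2 else 0) ≤ 1 / 2 := by
  set s := (startC hm hm₁ B G : LCirc (Wire n m k)).run (bket (initW b)) with hs
  have htot : ∑ w, ‖s w‖ ^ 2 = 1 := by rw [hs, LCirc.sum_norm_run, sum_norm_bket]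
  -- Flipping the scaling qubit preserves the amplitudes and makes marked strings unmarked; hence
  -- the marked weight is at most half of the total.
  have hflip : ∑ w, (if Marked y w then ‖s w‖ ^ 2 else 0)
      = ∑ w, (if Marked y (w + Pi.single sw 1) then ‖s w‖ ^ 2 else 0) := by
    refine Fintype.sum_bijective (fun w => w + Pi.single sw 1)
      (Function.Involutive.bijective fun w => ?_) _ _ fun w => ?_
    · funext q
      by_cases hq : q = sw
      · subst hq
        simp [add_assoc, show (1 + 1 : ZMod 2) = 0 from rfl]
      · simp [hq]
    · have h1 : w + Pi.single sw 1 + Pi.single sw 1 = w := by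
        funext q
        by_cases hq : q = sw
        · subst hq
          simp [add_assoc, show (1 + 1 : ZMod 2) = 0 from rfl]
        · simp [hq]
      have h2 : Function.update (w + Pi.single sw 1) sw 0 = Function.update w sw 0 := by
        funext q
        by_cases hq : q = sw
        · subst hq; simp
        · simp [hq]
      rw [h1, hs, run_startC, run_startC, h2]
  have hle : ∑ w, (if Marked y w then ‖s w‖ ^ 2 else 0)
      + ∑ w, (if Marked y (w + Pi.single sw 1) then ‖s w‖ ^ 2 else 0) ≤ ∑ w, ‖s w‖ ^ 2 := by
    rw [← Finset.sum_add_distrib]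
    refine Finset.sum_le_sum fun w _ => ?_
    by_cases h1 : Marked y w
    · have h2 : ¬ Marked y (w + Pi.single sw 1) := by
        intro h2
        have := h2.1
        rw [Pi.add_apply, h1.1, Pi.single_eq_same] at this
        exact absurd this (by decide)
      simp [h1, h2]
    · simp only [h1, if_false, zero_add]
      split_ifs
      · exact le_rfl
      · positivity
  linarith

/-- It is enough to keep the one marked string with candidate y, scaling qubit 1 and a clean
workspace. -/
lemma le_startC_weight (hm : n + n ≤ m) (hm₁ : 1 ≤ m) (B : Finset (Fin n)) (G : LCirc (Fin m))
    (b y : Bits n) :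
    ‖(signC hm hm₁ B G : LCirc (Wire n m k)).run (bket (initW b)) (candW b y)‖ ^ 2 / 2
      ≤ ∑ w, (if Marked y w then
        ‖(startC hm hm₁ B G : LCirc (Wire n m k)).run (bket (initW b)) w‖ ^ 2 else 0) := by
  have h := Finset.single_le_sum (s := Finset.univ)
    (f := fun w => if Marked y w then
        ‖(startC hm hm₁ B G : LCirc (Wire n m k)).run (bket (initW b)) w‖ ^ 2 else 0)
    (fun w _ => by positivity) (Finset.mem_univ (Function.update (candW b y) sw 1))
  refine le_trans (le_of_eq ?_) h
  have hM : Marked y (Function.update (candW b y : Wire n m k → ZMod 2) sw 1) := by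
    refine ⟨by simp, fun i => ?_⟩
    rw [Function.update_of_ne (by simp [xw, sw])]; rfl
  have hc : Function.update (candW b y : Wire n m k → ZMod 2) sw 0 = candW b y :=
    Function.update_eq_self_iff.mpr rfl
  have hr : ‖rt‖ ^ 2 = 1 / 2 := by
    rw [sq, ← norm_mul, rt_mul_rt]; norm_num
  simp only [hM, if_true]
  rw [run_startC, Function.update_idem, hc, norm_mul, mul_pow, hr]
  ring

end Amplitude

/-! ### Circuits on numbered qubits -/

section Transfer

variable {n m k : ℕ}

/-- A gate on numbered qubits as a gate on labelled qubits. -/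
def Gate.toL : Gate m → LGate (Fin m)
  | .one i U => .one i U
  | .two i j h U => .two i j h U

/-- A gate on qubits labelled by numbers. -/
def LGate.toGate : LGate (Fin m) → Gate m
  | .one i U => .one i U
  | .two i j h U => .two i j h U

/-- A circuit on numbered qubits as a circuit on labelled qubits. -/
def Circuit.toL (C : Circuit m) : LCirc (Fin m) := List.map Gate.toL C

/-- A circuit on qubits labelled by numbers. -/
def LCirc.toCircuit (C : LCirc (Fin m)) : Circuit m := List.map LGate.toGate C

lemma Circuit.run_toL (C : Circuit m) (ψ : QState m) : C.toL.run ψ = Circuit.run C ψ := by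
  induction C generalizing ψ with
  | nil => rfl
  | cons g C ih =>
    have : g.toL.apply ψ = Gate.apply g ψ := by cases g <;> rfl
    change LCirc.run (Circuit.toL C) (g.toL.apply ψ) = Circuit.run C (Gate.apply g ψ)
    rw [this]
    exact ih _

lemma LCirc.run_toCircuit (C : LCirc (Fin m)) (ψ : QState m) :
    Circuit.run C.toCircuit ψ = C.run ψ := by
  induction C generalizing ψ with
  | nil => rfl
  | cons g C ih =>
    have : Gate.apply g.toGate ψ = g.apply ψ := by cases g <;> rfl
    change Circuit.run (LCirc.toCircuit C) (Gate.apply g.toGate ψ) = LCirc.run C (g.apply ψ)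
    rw [this]
    exact ih _

lemma Circuit.length_toL (C : Circuit m) : C.toL.length = C.size := by
  simp [Circuit.toL, Circuit.size]

lemma LCirc.size_toCircuit (C : LCirc (Fin m)) : C.toCircuit.size = C.length := by
  simp [LCirc.toCircuit, Circuit.size]

lemma Circuit.outProb_eq {l : ℕ} (C : Circuit m) (hn : n ≤ m) (hl : l ≤ m) (x : Bits n)
    (z : Bits l) : Circuit.outProb C hn hl x z
      = ∑ w, (if ∀ i, w (Fin.castLE hl i) = z i then ‖C.toL.run (bket (padZero m x)) w‖ ^ 2
          else 0) := by
  rw [Circuit.outProb, Circuit.run_toL]; rfl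

lemma Circuit.outProb_nonneg {l : ℕ} (C : Circuit m) (hn : n ≤ m) (hl : l ≤ m) (x : Bits n)
    (z : Bits l) : 0 ≤ Circuit.outProb C hn hl x z := by
  refine Finset.sum_nonneg fun w _ => ?_
  split_ifs <;> positivity

lemma Circuit.outProb_le_one {l : ℕ} (C : Circuit m) (hn : n ≤ m) (hl : l ≤ m) (x : Bits n)
    (z : Bits l) : Circuit.outProb C hn hl x z ≤ 1 := by
  rw [Circuit.outProb_eq, ← sum_norm_bket (padZero m x), ← C.toL.sum_norm_run]
  refine Finset.sum_le_sum fun w _ => ?_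
  split_ifs
  · exact le_rfl
  · positivity

/-- The numbering of the qubits of the inverter, with the input first. -/
noncomputable def wireEquiv : Wire n m k ≃ Fin (n + Fintype.card (Reg n m k)) :=
  (Equiv.sumCongr (Equiv.refl _) (Fintype.equivFin _)).trans finSumFinEquiv

lemma wireEquiv_inl (i : Fin n) :
    (wireEquiv (Sum.inl i) : Fin (n + Fintype.card (Reg n m k)))
      = Fin.castLE (Nat.le_add_right _ _) i := by
  simp [wireEquiv]; rfl

/-- A circuit on the qubits of the inverter as a circuit on numbered qubits. -/
noncomputable def LCirc.numbered (C : LCirc (Wire n m k)) :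
    Circuit (n + Fintype.card (Reg n m k)) :=
  (LCirc.emb wireEquiv.toEmbedding C).toCircuit

lemma padZero_wireEquiv (b : Bits n) :
    padZero (n + Fintype.card (Reg n m k)) b ∘ wireEquiv = initW b := by
  funext q
  rcases q with i | r
  · rw [Function.comp_apply, wireEquiv_inl, padZero_castLE]; rfl
  · simp [wireEquiv, padZero, initW]

lemma LCirc.outProb_numbered (C : LCirc (Wire n m k)) (b y : Bits n) :
    Circuit.outProb C.numbered (Nat.le_add_right _ _) (Nat.le_add_right _ _) b y
      = ∑ w, (if ∀ i, w (Sum.inl i) = y i then ‖C.run (bket (initW b)) w‖ ^ 2 else 0) := by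
  have hrun : ∀ w : Bits (n + Fintype.card (Reg n m k)),
      Circuit.run C.numbered (ket (padZero _ b)) w
        = C.run (bket (initW b)) (w ∘ wireEquiv) := by
    intro w
    rw [LCirc.numbered, LCirc.run_toCircuit, LCirc.run_emb]
    have : (fun u : Wire n m k → ZMod 2 =>
        ket (padZero (n + Fintype.card (Reg n m k)) b)
          (Function.extend (wireEquiv.toEmbedding) u w)) = bket (initW b) := by
      funext u
      have hu : Function.extend (wireEquiv.toEmbedding) u w = u ∘ wireEquiv.symm := by
        funext q
        obtain ⟨q, rfl⟩ := wireEquiv.surjective q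
        simp
      simp only [ket, bket]
      congr 1
      refine propext ?_
      rw [hu, ← padZero_wireEquiv, Equiv.comp_symm_eq]
    rw [this]; rfl
  rw [Circuit.outProb]
  refine Fintype.sum_equiv (Equiv.arrowCongr wireEquiv.symm (Equiv.refl _)) _ _ fun w => ?_
  rw [hrun]
  have e : (Equiv.arrowCongr wireEquiv.symm (Equiv.refl _)) w
      = (w ∘ (wireEquiv : Wire n m k ≃ _)) := rfl
  simp only [e, Function.comp_apply, wireEquiv_inl]

end Transfer

/-! ### Consequences of the hypotheses -/

section Hypotheses

variable {n m k : ℕ}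

lemma Circuit.Computes.eq_of_run_ne_zero {F : Circuit k} {hk : n ≤ k} {f : Bits n → Bits n}
    (hF : Circuit.Computes F hk f) (x : Bits n) (v : Bits k)
    (hv : F.toL.run (bket (padZero k x)) v ≠ 0) (i : Fin n) : v (Fin.castLE hk i) = f x i := by
  by_contra hne
  have h1 := hF x
  rw [Circuit.outProb_eq] at h1
  have h2 : ∑ w, ‖F.toL.run (bket (padZero k x)) w‖ ^ 2 = 1 := by
    rw [LCirc.sum_norm_run, sum_norm_bket]
  have h3 : ∑ w : Bits k, (if ∀ i, w (Fin.castLE hk i) = f x i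
      then ‖F.toL.run (bket (padZero k x)) w‖ ^ 2 else 0)
      < ∑ w, ‖F.toL.run (bket (padZero k x)) w‖ ^ 2 := by
    refine Finset.sum_lt_sum (fun w _ => ?_) ⟨v, Finset.mem_univ _, ?_⟩
    · split_ifs
      · exact le_rfl
      · positivity
    · rw [if_neg (fun h => hne (h i))]
      positivity
  linarith

/-- An untouched qubit keeps its input value in every string of the final state, and all these
strings display f(x). -/
lemma Circuit.Computes.eq_of_notMem_touched {F : Circuit k} {hk : n ≤ k} {f : Bits n → Bits n}
    (hF : Circuit.Computes F hk f) (x : Bits n) {i : Fin n}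
    (hi : Fin.castLE hk i ∉ F.toL.touched) : f x i = x i := by
  have h2 : ∑ w, ‖F.toL.run (bket (padZero k x)) w‖ ^ 2 = 1 := by
    rw [LCirc.sum_norm_run, sum_norm_bket]
  obtain ⟨v, -, hv⟩ := Finset.exists_ne_zero_of_sum_ne_zero (by rw [h2]; exact one_ne_zero)
  have hv' : F.toL.run (bket (padZero k x)) v ≠ 0 := fun h => hv (by simp [h])
  obtain ⟨w', h3, h4⟩ := F.toL.keeps_of_disjoint (A := {Fin.castLE hk i})
    (by rintro q rfl; exact hi) _ _ hv'
  have h5 : w' = padZero k x := by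
    by_contra hne
    simp [bket, hne] at h3
  rw [← hF.eq_of_run_ne_zero x v hv' i, ← h4 _ rfl, h5, padZero_castLE]

lemma Circuit.outProb_eq_signExp {l : ℕ} (G : Circuit m) (hl : l ≤ m) (hm₁ : 1 ≤ m) (z : Bits l)
    (a : ZMod 2) :
    ((2 * Circuit.outProb G hl hm₁ z (fun _ => a) - 1 : ℝ) : ℂ)
      = sgn a * signExp hm₁ G.toL (padZero m z) := by
  have h2 : ∑ w, ‖G.toL.run (bket (padZero m z)) w‖ ^ 2 = 1 := by
    rw [LCirc.sum_norm_run, sum_norm_bket]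
  rw [Circuit.outProb_eq, ← h2, Finset.mul_sum, ← Finset.sum_sub_distrib, signExp,
    Finset.mul_sum, Complex.ofReal_sum]
  refine Finset.sum_congr rfl fun u _ => ?_
  have hc : (∀ i : Fin 1, u (Fin.castLE hm₁ i) = a) ↔ u ⟨0, hm₁⟩ = a :=
    ⟨fun h => h 0, fun h i => by rw [Subsingleton.elim i 0]; exact h⟩
  simp only [hc]
  rcases zmod_two_cases a with rfl | rfl <;> rcases zmod_two_cases (u ⟨0, hm₁⟩) with h | h <;>
    simp [h] <;> ring

lemma ofReal_predProb (G : Circuit m) (hm : n + n ≤ m) (hm₁ : 1 ≤ m) (f : Equiv.Perm (Bits n))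
    (y : Bits n) :
    ((2 * Circuit.predProb G hm hm₁ f y - 1 : ℝ) : ℂ)
      = (∑ x : Bits n, sgn (∑ i, x i * y i) *
          signExp hm₁ G.toL (padZero m (Fin.append (f y) x))) / 2 ^ n := by
  have h1 : (2 * Circuit.predProb G hm hm₁ f y - 1 : ℝ)
      = (∑ x : Bits n, (2 * Circuit.outProb G hm hm₁ (Fin.append (f y) x)
          (fun _ => hardPred y x) - 1)) / 2 ^ n := by
    rw [Circuit.predProb, Finset.sum_sub_distrib, ← Finset.mul_sum]
    simp only [tildeMap, Equiv.prodCongr_apply, Prod.map, Equiv.refl_apply]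
    rw [Finset.sum_const, Finset.card_univ, Fintype.card_fun, ZMod.card, Fintype.card_fin]
    field_simp
    simp
  rw [h1, Complex.ofReal_div, Complex.ofReal_sum]
  congr 1
  · refine Finset.sum_congr rfl fun x _ => ?_
    rw [Circuit.outProb_eq_signExp, hardPred, dotProduct]
    simp only [mul_comm]
  · push_cast; rfl

/-! ### Bits on which the predictor does not act -/

lemma signExp_flip (hm₁ : 1 ≤ m) (G : LCirc (Fin m)) (z : Bits m) {q : Fin m}
    (hq : q ∉ G.touched) (hq0 : q ≠ ⟨0, hm₁⟩) :
    signExp hm₁ G (z + Pi.single q 1) = signExp hm₁ G z := by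
  have hinv : Function.Involutive fun w : Bits m => w + Pi.single q 1 := by
    intro w
    funext r
    by_cases hr : r = q
    · subst hr; simp [add_assoc, show (1 + 1 : ZMod 2) = 0 from rfl]
    · simp [hr]
  have hket : (bket (z + Pi.single q 1) : Amp (Fin m)) = fun v => bket z (v + Pi.single q 1) := by
    funext v
    simp only [bket]
    congr 1
    refine propext ⟨fun h => ?_, fun h => ?_⟩
    · rw [h]; exact hinv z
    · rw [← h]; exact (hinv v).symm
  rw [signExp, signExp]
  refine Fintype.sum_bijective _ hinv.bijective _ _ fun w => ?_
  rw [hket, LCirc.run_flip G hq]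
  simp [Pi.single_eq_of_ne hq0.symm]

lemma padZero_append_flip (hm : n + n ≤ m) (b x : Bits n) (i : Fin n) :
    padZero m (Fin.append b (x + Pi.single i 1))
      = padZero m (Fin.append b x) + Pi.single (xIdx hm i) 1 := by
  funext j
  rw [Pi.add_apply]
  rcases idx_cases hm j with ⟨i', rfl⟩ | ⟨i', rfl⟩ | hj
  · rw [padZero_yIdx, padZero_yIdx, Pi.single_eq_of_ne, add_zero]
    intro h
    simp only [yIdx, xIdx, Fin.ext_iff, Fin.val_castLE, Fin.val_castAdd, Fin.val_natAdd] at h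
    omega
  · rw [padZero_xIdx, padZero_xIdx, Pi.add_apply]
    by_cases hi : i' = i
    · subst hi; simp
    · rw [Pi.single_eq_of_ne hi, Pi.single_eq_of_ne]
      intro h
      simp only [xIdx, Fin.ext_iff, Fin.val_castLE, Fin.val_natAdd] at h
      exact hi (Fin.ext (by omega))
  · rw [Pi.single_eq_of_ne, add_zero]
    · simp [padZero, Nat.not_lt.mpr hj]
    · intro h
      simp only [xIdx, Fin.ext_iff, Fin.val_castLE, Fin.val_natAdd] at h
      omega

lemma signExp_append_flip (hm : n + n ≤ m) (hm₁ : 1 ≤ m) (G : LCirc (Fin m)) (b x : Bits n)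
    {i : Fin n} (hi : xIdx hm i ∉ G.touched) :
    signExp hm₁ G (padZero m (Fin.append b (x + Pi.single i 1)))
      = signExp hm₁ G (padZero m (Fin.append b x)) := by
  rw [padZero_append_flip hm, signExp_flip hm₁ G _ hi]
  -- The position n + i is never the output qubit 0, since the existence of `i : Fin n` forces n >
  -- 0.
  intro h
  simp only [xIdx, Fin.ext_iff, Fin.val_castLE, Fin.val_natAdd] at h
  omega

lemma add_single_add_single (x : Bits n) (i : Fin n) :
    x + Pi.single i 1 + Pi.single i 1 = x := by
  funext r
  by_cases hr : r = i
  · subst hr; simp [add_assoc, show (1 + 1 : ZMod 2) = 0 from rfl]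
  · simp [hr]

/-- A correctly predicted string vanishes at the bits that the predictor ignores. -/
lemma eq_zero_of_predProb (G : Circuit m) (hm : n + n ≤ m) (hm₁ : 1 ≤ m) (f : Equiv.Perm (Bits n))
    (y : Bits n) {ε : ℝ} (hε : 0 < ε) (hy : 1 / 2 + ε ≤ Circuit.predProb G hm hm₁ f y)
    {i : Fin n} (hi : xIdx hm i ∉ G.toL.touched) : y i = 0 := by
  by_contra hne
  have hyi : y i = 1 := (zmod_two_cases _).resolve_left hne
  have h := ofReal_predProb G hm hm₁ f y
  set S := ∑ x : Bits n, sgn (∑ i, x i * y i) *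
          signExp hm₁ G.toL (padZero m (Fin.append (f y) x)) with hS
  -- Flipping the ignored bit reverses the parity, because `y i = 1`, but not the prediction.
  have hneg : S = -S := by
    conv_lhs => rw [hS]
    rw [hS, ← Finset.sum_neg_distrib]
    refine Fintype.sum_bijective (fun x : Bits n => x + Pi.single i 1)
      (Function.Involutive.bijective fun x => add_single_add_single x i) _ _ fun x => ?_
    rw [signExp_append_flip hm hm₁ G.toL _ _ hi]
    have : ∑ r, (x + Pi.single i 1 : Bits n) r * y r = ∑ r, x r * y r + 1 := by
      simp only [Pi.add_apply, add_mul, Finset.sum_add_distrib]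
      congr 1
      rw [Finset.sum_eq_single i]
      · simp [hyi]
      · intro r _ hr; simp [hr]
      · simp
    rw [this, sgn_add, sgn_one]
    ring
  have hS0 : S = 0 := self_eq_neg.mp hneg
  rw [hS0, zero_div] at h
  have h' : 2 * Circuit.predProb G hm hm₁ f y - 1 = 0 := by exact_mod_cast h
  linarith

lemma sum_suppSet_insert {B : Finset (Fin n)} {i : Fin n} (hi : i ∉ B) (Φ : Bits n → ℂ)
    (hΦ : ∀ x, Φ (x + Pi.single i 1) = Φ x) :
    ∑ x ∈ suppSet (insert i B), Φ x = 2 * ∑ x ∈ suppSet B, Φ x := by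
  rw [← Finset.sum_filter_add_sum_filter_not (suppSet (insert i B)) (fun x => x i = 0), two_mul]
  congr 1
  · refine Finset.sum_congr ?_ fun _ _ => rfl
    ext x
    simp only [Finset.mem_filter, mem_suppSet, Finset.mem_insert, not_or]
    constructor
    · rintro ⟨h1, h2⟩ j hj
      by_cases hji : j = i
      · rw [hji, h2]
      · exact h1 j ⟨hji, hj⟩
    · exact fun h => ⟨fun j hj => h j hj.2, h i hi⟩
  · refine Finset.sum_nbij' (fun x => x + Pi.single i 1) (fun x => x + Pi.single i 1) ?_ ?_
      (fun x _ => add_single_add_single x i) (fun x _ => add_single_add_single x i)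
      (fun x _ => (hΦ x).symm)
    · intro x hx
      simp only [Finset.mem_filter, mem_suppSet, Finset.mem_insert, not_or] at hx ⊢
      intro j hj
      by_cases hji : j = i
      · subst hji
        rw [Pi.add_apply, (zmod_two_cases _).resolve_left hx.2]
        simp [show (1 + 1 : ZMod 2) = 0 from rfl]
      · simp [hji, hx.1 j ⟨hji, hj⟩]
    · intro x hx
      simp only [Finset.mem_filter, mem_suppSet, Finset.mem_insert, not_or] at hx ⊢
      refine ⟨fun j hj => ?_, ?_⟩
      · simp [hj.1, hx j hj.2]
      · simp [hx i hi]

/-- Every coordinate outside `B` merely doubles the sum, so the mean over all strings is the mean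
over those supported on `B`. -/
lemma sum_eq_sum_suppSet (B : Finset (Fin n)) (Φ : Bits n → ℂ)
    (hΦ : ∀ i ∉ B, ∀ x, Φ (x + Pi.single i 1) = Φ x) :
    (∑ x, Φ x) / 2 ^ n = (1 / 2) ^ B.card * ∑ x ∈ suppSet B, Φ x := by
  have key : ∀ T : Finset (Fin n), Disjoint T B →
      ∑ x ∈ suppSet (T ∪ B), Φ x = 2 ^ T.card * ∑ x ∈ suppSet B, Φ x := by
    intro T
    induction T using Finset.induction_on with
    | empty => simp
    | insert i T hi ih =>
      intro hd
      rw [Finset.disjoint_insert_left] at hd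
      rw [Finset.insert_union, sum_suppSet_insert (by simp [hi, hd.1]) Φ (hΦ i hd.1), ih hd.2,
        Finset.card_insert_of_notMem hi]
      ring
  have h := key Bᶜ disjoint_compl_left
  have hu : suppSet (Bᶜ ∪ B) = (Finset.univ : Finset (Bits n)) := by
    ext x; simp [mem_suppSet]
  have hcard : B.card + (Bᶜ).card = n := by
    rw [Finset.card_compl, Fintype.card_fin]
    have := Finset.card_le_univ B
    rw [Fintype.card_fin] at this
    omega
  rw [hu] at h
  have hp : (2 : ℂ) ^ n = 2 ^ B.card * 2 ^ (Bᶜ).card := by rw [← pow_add, hcard]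
  rw [h, hp, one_div, inv_pow]
  field_simp

/-- The circuit averages over x supported on `B`, the predictor's advantage over all x. The means
agree because bits outside `B` affect neither the prediction nor the parity with y. -/
lemma signC_amplitude_eq (G : Circuit m) (hm : n + n ≤ m) (hm₁ : 1 ≤ m) (f : Equiv.Perm (Bits n))
    {B : Finset (Fin n)} (hG : ∀ i ∉ B, xIdx hm i ∉ G.toL.touched)
    {y : Bits n} (hb : ∀ i ∉ B, f y i = 0) (hy : ∀ i ∉ B, y i = 0) :
    (signC hm hm₁ B G.toL : LCirc (Wire n m k)).run (bket (initW (f y))) (candW (f y) y)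
      = ((2 * Circuit.predProb G hm hm₁ f y - 1 : ℝ) : ℂ) := by
  have hsum : ∀ x : Bits n, ∑ i, x i * y i = ∑ i ∈ B, x i * y i := fun x =>
    (Finset.sum_subset (Finset.subset_univ B) fun i _ hi => by rw [hy i hi, mul_zero]).symm
  rw [signC_amplitude hm hm₁ G.toL hb hy, ofReal_predProb]
  simp only [hsum]
  rw [sum_eq_sum_suppSet B]
  intro i hi x
  rw [signExp_append_flip hm hm₁ G.toL _ _ (hG i hi)]
  congr 2
  refine Finset.sum_congr rfl fun r hr => ?_
  rw [Pi.add_apply, Pi.single_eq_of_ne (fun h : r = i => hi (h ▸ hr)), add_zero]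

end Hypotheses

/-! ### The inverter's success probability -/

section Main

variable {n m k : ℕ}

/-- The positions at which the predictor or the circuit for `f` may depend on the candidate. -/
def relevant (hk : n ≤ k) (hm : n + n ≤ m) (F : LCirc (Fin k)) (G : LCirc (Fin m)) :
    Finset (Fin n) :=
  Finset.univ.filter fun i => Fin.castLE hk i ∈ F.touched ∨ xIdx hm i ∈ G.touched

lemma xIdx_injective (hm : n + n ≤ m) : Function.Injective (xIdx hm) := by
  intro i j h
  simp only [xIdx, Fin.ext_iff, Fin.val_castLE, Fin.val_natAdd] at h
  exact Fin.ext (by omega)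

lemma card_relevant_le (hk : n ≤ k) (hm : n + n ≤ m) (F : LCirc (Fin k)) (G : LCirc (Fin m)) :
    (relevant hk hm F G).card ≤ 2 * (G.length + F.length) := by
  rw [relevant, Finset.filter_or]
  have h1 : (Finset.univ.filter fun i => Fin.castLE hk i ∈ F.touched).card ≤ F.touched.card :=
    Finset.card_le_card_of_injOn (Fin.castLE hk) (fun i hi => by simpa using hi)
      (Fin.castLE_injective hk).injOn
  have h2 : (Finset.univ.filter fun i => xIdx hm i ∈ G.touched).card ≤ G.touched.card :=
    Finset.card_le_card_of_injOn (xIdx hm) (fun i hi => by simpa using hi)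
      (xIdx_injective hm).injOn
  have h3 := F.card_touched_le
  have h4 := G.card_touched_le
  have h5 := Finset.card_union_le (Finset.univ.filter fun i => Fin.castLE hk i ∈ F.touched)
    (Finset.univ.filter fun i => xIdx hm i ∈ G.touched)
  omega

/-- For every well predicted string there is an angle that governs the inverter's success. -/
lemma exists_angle {f : Equiv.Perm (Bits n)} {F : Circuit k} {hk : n ≤ k}
    (hF : Circuit.Computes F hk f) (G : Circuit m) (hm : n + n ≤ m) (hm₁ : 1 ≤ m) {ε : ℝ}
    (hε : 0 < ε) (y : Bits n) (hy : 1 / 2 + ε ≤ Circuit.predProb G hm hm₁ f y) :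
    ∃ θ : ℝ, Real.pi * ε < 4 * θ ∧ θ ≤ Real.pi / 4 ∧ ∀ j : ℕ,
      Real.sin ((2 * (j : ℝ) + 1) * θ) ^ 2 ≤
        Circuit.outProb (LCirc.numbered
          (invC hm hm₁ (relevant hk hm F.toL G.toL) G.toL F.toL j : LCirc (Wire n m k)))
          (Nat.le_add_right _ _) (Nat.le_add_right _ _) (f y) y := by
  set B := relevant hk hm F.toL G.toL with hB
  have hBF : ∀ i ∉ B, Fin.castLE hk i ∉ F.toL.touched := by
    intro i hi h; exact hi (by simp [hB, relevant, h])
  have hBG : ∀ i ∉ B, xIdx hm i ∉ G.toL.touched := by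
    intro i hi h; exact hi (by simp [hB, relevant, h])
  have hfix : ∀ x, ∀ i ∉ B, f x i = x i := fun x i hi => hF.eq_of_notMem_touched x (hBF i hi)
  have hy0 : ∀ i ∉ B, y i = 0 := fun i hi =>
    eq_zero_of_predProb G hm hm₁ f y hε hy (hBG i hi)
  have hb0 : ∀ i ∉ B, f y i = 0 := fun i hi => by rw [hfix y i hi, hy0 i hi]
  have setup : AmpSetup (startC hm hm₁ B G.toL : LCirc (Wire n m k)) (markC B F.toL)
      (reflC hm hm₁ B G.toL) (initW (f y)) (fixedW hm hm₁ B G.toL) (Marked y) :=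
    ampSetup hk hm hm₁ B G.toL F.toL f (hF.eq_of_run_ne_zero) hfix y hy0
  set p := ∑ w, (if Marked y w then
    ‖(startC hm hm₁ B G.toL : LCirc (Wire n m k)).run (bket (initW (f y))) w‖ ^ 2 else 0) with hp
  have hp1 : p ≤ 1 / 2 := startC_weight_le hm hm₁ B G.toL (f y) y
  -- The amplitude is at least 2ε; the scaling qubit halves its square.
  have hp2 : 2 * ε ^ 2 ≤ p := by
    have h1 := le_startC_weight (k := k) hm hm₁ B G.toL (f y) y
    rw [signC_amplitude_eq G hm hm₁ f hBG hb0 hy0, Complex.norm_real, Real.norm_eq_abs,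
      sq_abs] at h1
    refine le_trans ?_ h1
    nlinarith
  have hp0 : 0 < p := by
    have : 0 < ε ^ 2 := by positivity
    linarith
  have hsq : √p ^ 2 = p := Real.sq_sqrt hp0.le
  have hs0 : 0 < √p := Real.sqrt_pos.mpr hp0
  have hs1 : √p ≤ √2 / 2 := by
    rw [Real.sqrt_le_left (by positivity), div_pow, Real.sq_sqrt (by norm_num)]
    linarith
  have h2sq : √2 ^ 2 = (2 : ℝ) := Real.sq_sqrt (by norm_num)
  have h2lt : √2 < 1.5 := by
    rw [Real.sqrt_lt' (by norm_num)]; norm_num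
  set θ := Real.arcsin √p with hθ
  have hsin : Real.sin θ = √p := Real.sin_arcsin (by linarith) (by linarith)
  have hθ0 : 0 < θ := Real.arcsin_pos.mpr hs0
  have hpi := Real.pi_pos
  have hθ1 : θ ≤ Real.pi / 4 := by
    rw [hθ, Real.arcsin_le_iff_le_sin' ⟨by linarith, by linarith⟩, Real.sin_pi_div_four]
    exact hs1
  have hweight : ∑ w, (if Marked y w then
      ‖(startC hm hm₁ B G.toL : LCirc (Wire n m k)).run (bket (initW (f y))) w‖ ^ 2 else 0)
      = Real.sin θ ^ 2 := by rw [hsin, hsq]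
  refine ⟨θ, ?_, hθ1, fun j => ?_⟩
  -- Here θ > sin θ = √p ≥ √2 ε ≥ (7/5) ε, and 4 · 7/5 exceeds π.
  · have h1 : √p < θ := by
      have := Real.sin_lt hθ0
      rwa [hsin] at this
    have h2 : (7 / 5 * ε) ≤ √p := by
      refine Real.le_sqrt_of_sq_le ?_
      nlinarith
    have h3 := Real.pi_lt_d2
    nlinarith
  · rw [LCirc.outProb_numbered, invC, LCirc.run_append, ← setup.weight_grover hθ0 hθ1 hweight j]
    refine outWeight_le B _ (f y) y (hfix y) fun w hw i => ?_
    exact setup.supp_grover hθ0 hθ1 hweight j w hw (Sum.inl i)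
      (mem_fixedW (by simp [sw]) (by simp [xw]) (by simp [gw_apply]))

lemma Circuit.predProb_le_one (G : Circuit m) (hm : n + n ≤ m) (hm₁ : 1 ≤ m)
    (f : Equiv.Perm (Bits n)) (y : Bits n) : Circuit.predProb G hm hm₁ f y ≤ 1 := by
  rw [Circuit.predProb, div_le_one (by positivity)]
  refine (Finset.sum_le_sum fun x _ => Circuit.outProb_le_one _ _ _ _ _).trans ?_
  rw [Finset.sum_const, Finset.card_univ, Fintype.card_fun, ZMod.card, Fintype.card_fin]
  simp

lemma Circuit.invProb_nonneg (C : Circuit m) (hm : n ≤ m) (f : Equiv.Perm (Bits n)) :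
    0 ≤ Circuit.invProb C hm f :=
  div_nonneg (Finset.sum_nonneg fun _ _ => Circuit.outProb_nonneg _ _ _ _ _) (by positivity)

lemma invProb_nil_one : Circuit.invProb ([] : Circuit n) le_rfl (Equiv.refl _) = 1 := by
  have h : ∀ a : Bits n, Circuit.outProb ([] : Circuit n) le_rfl le_rfl a a = 1 := by
    intro a
    have hp : padZero n a = a := by funext i; simp [padZero]
    have hc : ∀ w : Bits n, (∀ i, w (Fin.castLE le_rfl i) = a i) ↔ w = a :=
      fun w => ⟨fun h => funext fun i => h i, fun h i => congrFun h i⟩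
    simp only [Circuit.outProb, hp, hc]
    simp [Circuit.run, ket]
  rw [Circuit.invProb]
  simp only [Equiv.refl_apply, h]
  rw [Finset.sum_const, Finset.card_univ, Fintype.card_fun, ZMod.card, Fintype.card_fin]
  simp

/-- If the bound failed, the inverter would have at most `T` gates and succeed with probability at
least δ/2. -/
theorem size_lower_bound (f : Equiv.Perm (Bits n)) (δ ε : ℝ) (T : ℕ) (hk : n ≤ k)
    (F : Circuit k) (hm : n + n ≤ m) (hm₁ : 1 ≤ m) (G : Circuit m)
    (hard : QHardToInvert f (δ / 2) T) (hF : Circuit.Computes F hk f)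
    (hG : Circuit.Predicts G hm hm₁ f δ ε) :
    1 / 500 * (T : ℝ) * ε ≤ (Circuit.size G : ℝ) + (Circuit.size F : ℝ) := by
  by_contra hcon
  push Not at hcon
  have hT : (0 : ℝ) ≤ T := Nat.cast_nonneg T
  have hGF : (0 : ℝ) ≤ (Circuit.size G : ℝ) + (Circuit.size F : ℝ) := by positivity
  have hε : 0 < ε := by
    by_contra h
    push Not at h
    nlinarith
  set Y : Finset (Bits n) :=
    Finset.univ.filter fun y => 1 / 2 + ε ≤ Circuit.predProb G hm hm₁ f y with hY
  have hδ : δ ≤ (Y.card : ℝ) / 2 ^ n := by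
    have : (Set.ncard {y : Bits n | 1 / 2 + ε ≤ Circuit.predProb G hm hm₁ f y}) = Y.card := by
      rw [← Set.ncard_coe_finset, hY]; congr 1; ext; simp
    have h := hG
    rwa [Circuit.Predicts, this] at h
  -- Without a well predicted string, δ ≤ 0 and even the empty circuit contradicts hardness.
  -- Otherwise ε ≤ 1/2, which is used for N ≥ 1.
  rcases Y.eq_empty_or_nonempty with hE | ⟨y₀, hy₀⟩
  · refine hard ⟨n, le_rfl, [], Nat.zero_le _, ?_⟩
    rw [hE] at hδ
    simp only [Finset.card_empty, Nat.cast_zero, zero_div] at hδ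
    linarith [Circuit.invProb_nonneg ([] : Circuit n) le_rfl f]
  have hε2 : ε ≤ 1 / 2 := by
    have h1 := (Finset.mem_filter.mp hy₀).2
    have h2 := Circuit.predProb_le_one G hm hm₁ f y₀
    linarith
  set σ := G.size + F.size with hσ
  -- The gate count needs σ ≥ 1. If there are no gates at all, `f` is the identity and the empty
  -- circuit inverts it.
  rcases Nat.eq_zero_or_pos σ with h0 | hpos
  · have hF0 : F.toL = [] := List.length_eq_zero_iff.mp (by rw [Circuit.length_toL]; omega)
    have hf : f = Equiv.refl _ := by
      ext x i
      rw [hF.eq_of_notMem_touched x (by simp [hF0])]; rfl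
    refine hard ⟨n, le_rfl, [], Nat.zero_le _, ?_⟩
    rw [hf, invProb_nil_one]
    have h1 : (Y.card : ℝ) ≤ 2 ^ n := by
      have := Finset.card_le_univ Y
      rw [Fintype.card_fun, ZMod.card, Fintype.card_fin] at this
      exact_mod_cast this
    have h2 : (Y.card : ℝ) / 2 ^ n ≤ 1 := by rwa [div_le_one (by positivity)]
    linarith
  have hinv : 2 ≤ 1 / ε := by rw [le_div_iff₀ hε]; linarith
  -- N + 1 is the least integer that is at least 1/ε, so that π/(N+1) ≤ πε < 4θ, as the averaging
  -- over j requires.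
  obtain ⟨N, hN⟩ : ∃ N, ⌈1 / ε⌉₊ = N + 1 :=
    Nat.exists_eq_succ_of_ne_zero (Nat.ceil_pos.mpr (by positivity)).ne'
  have hN1 : 1 / ε ≤ (N : ℝ) + 1 := by
    have := Nat.le_ceil (1 / ε)
    rw [hN] at this
    exact_mod_cast this
  have hN2 : (N : ℝ) + 1 < 1 / ε + 1 := by
    have := Nat.ceil_lt_add_one (show 0 ≤ 1 / ε by positivity)
    rw [hN] at this
    exact_mod_cast this
  have hN0 : 1 ≤ N := by
    have : (1 : ℝ) ≤ N := by linarith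
    exact_mod_cast this
  have hpN : Real.pi / (N + 1) ≤ Real.pi * ε := by
    rw [div_le_iff₀ (by positivity), mul_assoc]
    refine le_mul_of_one_le_right Real.pi_pos.le ?_
    rwa [div_le_iff₀' hε] at hN1
  have hang : ∀ y : Bits n, ∃ θ : ℝ, y ∈ Y → Real.pi * ε < 4 * θ ∧ θ ≤ Real.pi / 4 ∧ ∀ j : ℕ,
      Real.sin ((2 * (j : ℝ) + 1) * θ) ^ 2 ≤
        Circuit.outProb (LCirc.numbered
          (invC hm hm₁ (relevant hk hm F.toL G.toL) G.toL F.toL j : LCirc (Wire n m k)))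
          (Nat.le_add_right _ _) (Nat.le_add_right _ _) (f y) y := by
    intro y
    by_cases hy : y ∈ Y
    · obtain ⟨θ, h⟩ := exists_angle hF G hm hm₁ hε y (Finset.mem_filter.mp hy).2
      exact ⟨θ, fun _ => h⟩
    · exact ⟨0, fun h => absurd h hy⟩
  choose θ hθ using hang
  obtain ⟨j, hj, hsum⟩ := exists_iterations Y θ hN0
    (fun y hy => hpN.trans_lt (hθ y hy).1) (fun y hy => (hθ y hy).2.1)
  refine hard ⟨_, Nat.le_add_right _ _, LCirc.numbered
    (invC hm hm₁ (relevant hk hm F.toL G.toL) G.toL F.toL j : LCirc (Wire n m k)), ?_, ?_⟩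
  · have hlen := length_invC_le (k := k) hm hm₁ (relevant hk hm F.toL G.toL) G.toL F.toL j
      (σ := σ) ((card_relevant_le hk hm F.toL G.toL).trans_eq
        (by rw [Circuit.length_toL, Circuit.length_toL]))
      (by rw [Circuit.length_toL, Circuit.length_toL]) hpos
    rw [LCirc.numbered, LCirc.size_toCircuit, LCirc.length_emb]
    refine hlen.trans ?_
    have h1 : (σ : ℝ) < 1 / 500 * T * ε := by rw [hσ]; push_cast; exact hcon
    have h2 : ((240 * σ * (j + 1) : ℕ) : ℝ) ≤ T := by
      push_cast
      -- Since j ≤ N < 1/ε and 1 ≤ 1/ε, the inverter has at most 480σ/ε gates; the constant 1/500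
      -- brings this below `T`.
      have hj' : (j : ℝ) + 1 ≤ 2 * (1 / ε) := by
        have : (j : ℝ) ≤ N := by exact_mod_cast hj
        linarith
      have hσ0 : (0 : ℝ) ≤ σ := Nat.cast_nonneg _
      calc (240 : ℝ) * σ * (j + 1) ≤ 240 * σ * (2 * (1 / ε)) := by gcongr
        _ ≤ 240 * (1 / 500 * T * ε) * (2 * (1 / ε)) := by gcongr
        _ = 24 / 25 * T := by field_simp; ring
        _ ≤ T := by linarith
    exact_mod_cast h2
  · rw [Circuit.invProb]
    have h1 : ∑ y ∈ Y, Real.sin ((2 * (j : ℝ) + 1) * θ y) ^ 2 ≤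
        ∑ a : Bits n, Circuit.outProb (LCirc.numbered
          (invC hm hm₁ (relevant hk hm F.toL G.toL) G.toL F.toL j : LCirc (Wire n m k)))
          (Nat.le_add_right _ _) (Nat.le_add_right _ _) (f a) a :=
      (Finset.sum_le_sum fun y hy => (hθ y hy).2.2 j).trans
        (Finset.sum_le_sum_of_subset_of_nonneg (Finset.subset_univ Y)
          fun _ _ _ => Circuit.outProb_nonneg _ _ _ _ _)
    have h2 : (Y.card : ℝ) / 2 ^ n / 2 = (Y.card : ℝ) / 2 / 2 ^ n := by ring
    calc δ / 2 ≤ (Y.card : ℝ) / 2 ^ n / 2 := by linarith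
      _ = (Y.card : ℝ) / 2 / 2 ^ n := h2
      _ ≤ _ := by gcongr; exact hsum.trans h1

end Main

end QuantumGL

theorem theorem4 :
    ∃ c : ℝ, 0 < c ∧
      ∀ (n : ℕ) (f : Equiv.Perm (QuantumGL.Bits n)) (δ ε : ℝ) (T : ℕ)
        (k : ℕ) (hk : n ≤ k) (F : QuantumGL.Circuit k)
        (m : ℕ) (hm : n + n ≤ m) (hm₁ : 1 ≤ m) (G : QuantumGL.Circuit m),
        QuantumGL.QHardToInvert f (δ / 2) T →
        QuantumGL.Circuit.Computes F hk f →
        QuantumGL.Circuit.Predicts G hm hm₁ f δ ε →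
        c * (T : ℝ) * ε ≤ (QuantumGL.Circuit.size G : ℝ) + (QuantumGL.Circuit.size F : ℝ) ∧
        ((QuantumGL.Circuit.size F : ℝ) ≤ c / 2 * (T : ℝ) * ε →
          c / 2 * (T : ℝ) * ε ≤ (QuantumGL.Circuit.size G : ℝ)) := by
  refine ⟨1 / 500, by norm_num, ?_⟩
  intro n f δ ε T k hk F m hm hm₁ G hard hF hG
  have h := QuantumGL.size_lower_bound f δ ε T hk F hm hm₁ G hard hF hG
  exact ⟨h, fun h' => by linarith⟩
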